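/- Let $d\ge 1$ and $\gamma_0>0$, and let $\Phi$ be the Poisson Boolean model of balls in $\mathbb R^d$ with intensity $\gamma_0$ and radii uniform on $[0,1]$, i.e. the Poisson particle process (a point process on the space $\mathcal K$ of non-empty compact subsets of $\mathbb R^d$ with the Hausdorff metric) whose intensity measure is the image of $\gamma_0\,\mathrm{Leb}\otimes\mathrm{Unif}[0,1]$ under $(x,r)\mapsto B_r(x)$, where $B_r(x)$ is the closed ball; $\Phi$ is defined on a probability space $(\Omega_0,\mathcal F_0,\mathbb P_0)$. For $a\ge 1$ put $h_a(B_r(x))=\exp(ar)$. A set $\psi$ of grains is hard-core if distinct grains of $\psi$ have disjoint interiors. A hard-core set $\psi\subset\varphi$ is a locally $h_a$-maximal thinning of $\varphi$ if for every hard-core $\psi'\subset\varphi$ with $\psi'\neq\psi$ and $\psi\Delta\psi'$ finite, $$\sum_{K\in\psi'\setminus\psi}h_a(K)<\sum_{K\in\psi\setminus\psi'}h_a(K).$$ A locally $h_a$-maximal particle process (with respect to $\Phi$) is a particle process $\Psi$ on some probability space $(\Omega,\mathcal F,\mathbb P)$, which may vary with $\Psi$, for which there is a measurable map $S:\Omega\to\Omega_0$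 with $\mathbb P\circ S^{-1}=\mathbb P_0$ such that $\Psi\subset\Phi\circ S$ almost surely, the pair $(\Phi\circ S,\Psi)$ is jointly stationary, and almost surely $\Psi$ is a locally $h_a$-maximal thinning of $\Phi\circ S$. Then there is $a_0\ge 1$, depending only on $d$ and $\gamma_0$, such that for every real $a\ge a_0$ all locally $h_a$-maximal particle processes with respect to $\Phi$ have the same distribution. -/

import Mathlib

open MeasureTheory ProbabilityTheory TopologicalSpace Set

noncomputable section

namespace HardCoreThinning

/-- Euclidean space `ℝ^d`. -/
abbrev Space (d : ℕ) : Type := EuclideanSpace ℝ (Fin d)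

/-- Grains (particles): the non-empty compact subsets of `ℝ^d`, with the Hausdorff metric. -/
abbrev Grain (d : ℕ) : Type := NonemptyCompacts (Space d)

/-- The space of grains carries the Borel σ-algebra of the Hausdorff metric. -/
instance grainMeasurableSpace (d : ℕ) : MeasurableSpace (Grain d) := borel (Grain d)

instance grainBorelSpace (d : ℕ) : BorelSpace (Grain d) := ⟨rfl⟩

/-- The translate `K + x` of a grain. -/
def translateGrain {d : ℕ} (x : Space d) (K : Grain d) : Grain d :=
  K.map (fun y => y + x) (continuous_add_const x)

theorem coe_translateGrain {d : ℕ} (x : Space d) (K : Grain d) :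
    (translateGrain x K : Set (Space d)) = (fun y => y + x) '' (K : Set (Space d)) := rfl

/-- The ball `B_r(x)` as a grain; a negative radius is read as `0`. -/
def ballGrain {d : ℕ} (x : Space d) (r : ℝ) : Grain d where
  carrier := Metric.closedBall x (max r 0)
  isCompact' := isCompact_closedBall x (max r 0)
  nonempty' := ⟨x, Metric.mem_closedBall_self (le_max_right r 0)⟩

theorem coe_ballGrain {d : ℕ} (x : Space d) {r : ℝ} (hr : 0 ≤ r) :
    (ballGrain x r : Set (Space d)) = Metric.closedBall x r := by
  change Metric.closedBall x (max r 0) = _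
  rw [max_eq_left hr]

/-- A set of grains is locally finite if every compact set is hit by only finitely many of
its grains. -/
def IsLocallyFinite {d : ℕ} (φ : Set (Grain d)) : Prop :=
  ∀ C : Set (Space d), IsCompact C → {K ∈ φ | ((K : Set (Space d)) ∩ C).Nonempty}.Finite

/-- Locally finite configurations of grains. -/
def Config (d : ℕ) : Type := {φ : Set (Grain d) // IsLocallyFinite φ}

/-- The set of grains of a configuration. -/
def Config.grains {d : ℕ} (φ : Config d) : Set (Grain d) := φ.1

/-- The number of grains of `φ` that belong to `B`. -/
def Config.count {d : ℕ} (B : Set (Grain d)) (φ : Config d) : ℕ∞ := (φ.grains ∩ B).encard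

/-- The σ-algebra on configurations generated by the counting variables of Borel sets. -/
instance configMeasurableSpace (d : ℕ) : MeasurableSpace (Config d) :=
  ⨆ B : {B : Set (Grain d) // MeasurableSet B},
    MeasurableSpace.comap (Config.count B.1) inferInstance

/-- The configuration `φ + x` obtained by translating all grains of `φ` by `x`. -/
def Config.translate {d : ℕ} (x : Space d) (φ : Config d) : Config d :=
  ⟨translateGrain x '' φ.grains, by
    intro C hC
    have h := φ.2 ((fun y => y + x) ⁻¹' C)
      ((Homeomorph.addRight x).isCompact_preimage.2 hC)
    refine (h.image (translateGrain x)).subset ?_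
    rintro _ ⟨⟨K, hK, rfl⟩, z, hz, hzC⟩
    rw [coe_translateGrain] at hz
    obtain ⟨y, hy, rfl⟩ := hz
    exact ⟨K, ⟨hK, y, hy, hzC⟩, rfl⟩⟩

/-- `Φ` is a Poisson particle process with intensity measure `Λ`: the number of grains in a
Borel set `B` of finite `Λ`-measure is Poisson distributed with mean `Λ B`, and the numbers of
grains in disjoint Borel sets are independent. -/
structure IsPoissonProcess {d : ℕ} {Ω : Type*} [MeasurableSpace Ω] (P : Measure Ω)
    (Λ : Measure (Grain d)) (Φ : Ω → Config d) : Prop where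
  measurable : Measurable Φ
  poisson : ∀ B : Set (Grain d), MeasurableSet B → Λ B ≠ ⊤ → ∀ n : ℕ,
    P {ω | (Φ ω).count B = n} = poissonMeasure (Λ B).toNNReal {n}
  indep : ∀ (n : ℕ) (B : Fin n → Set (Grain d)), (∀ i, MeasurableSet (B i)) →
    Pairwise (fun i j => Disjoint (B i) (B j)) →
    iIndepFun (fun i ω => (Φ ω).count (B i)) P

/-- The intensity measure of the Boolean model of balls with intensity `γ₀` whose radii are
uniform on `[0,1]`: the image of `γ₀ · Lebesgue ⊗ Unif[0,1]` under `(x, r) ↦ B_r(x)`. -/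
def booleanIntensity (d : ℕ) (γ₀ : ℝ) : Measure (Grain d) :=
  Measure.map (fun p : Space d × ℝ => ballGrain p.1 p.2)
    ((ENNReal.ofReal γ₀ • (volume : Measure (Space d))).prod
      ((volume : Measure ℝ).restrict (Icc 0 1)))

theorem continuous_ballGrain (d : ℕ) :
    Continuous (fun p : Space d × ℝ => ballGrain p.1 p.2) := by
  have key : ∀ (x y : Space d) (r s : ℝ), ∀ u ∈ Metric.closedBall x (max r 0),
      ∃ v ∈ Metric.closedBall y (max s 0), dist u v ≤ dist x y + |max r 0 - max s 0| := by
    intro x y r s u hu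
    rw [← affinity_unitClosedBall (le_max_right r 0)] at hu
    obtain ⟨_, ⟨w, hw, rfl⟩, rfl⟩ := hu
    refine ⟨y + (max s 0) • w, ?_, ?_⟩
    · rw [← affinity_unitClosedBall (le_max_right s 0)]
      exact ⟨_, ⟨w, hw, rfl⟩, rfl⟩
    · have hw1 : ‖w‖ ≤ 1 := by simpa using hw
      change dist (x + (max r 0) • w) (y + (max s 0) • w) ≤ _
      refine (dist_add_add_le _ _ _ _).trans ?_
      gcongr
      rw [dist_eq_norm, ← sub_smul, norm_smul, Real.norm_eq_abs]
      exact mul_le_of_le_one_right (abs_nonneg _) hw1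
  rw [continuous_iff_continuousAt]
  rintro ⟨x, r⟩
  rw [ContinuousAt, tendsto_iff_dist_tendsto_zero]
  have hlim : Filter.Tendsto (fun p : Space d × ℝ => dist p.1 x + |max p.2 0 - max r 0|)
      (nhds (x, r)) (nhds 0) := by
    have hc : Continuous (fun p : Space d × ℝ => dist p.1 x + |max p.2 0 - max r 0|) := by
      fun_prop
    simpa using hc.tendsto (x, r)
  refine squeeze_zero (fun _ => dist_nonneg) (fun p => ?_) hlim
  rw [Metric.NonemptyCompacts.dist_eq]
  refine Metric.hausdorffDist_le_of_mem_dist (by positivity) (key _ _ _ _) ?_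
  intro v hv
  obtain ⟨u, hu, h⟩ := key x p.1 r p.2 v hv
  refine ⟨u, hu, h.trans_eq ?_⟩
  rw [dist_comm, abs_sub_comm]

theorem measurable_ballGrain (d : ℕ) :
    Measurable (fun p : Space d × ℝ => ballGrain p.1 p.2) :=
  (continuous_ballGrain d).measurable

/-- The hard-core constraint: the interiors of distinct grains are disjoint. -/
def IsHardCore {d : ℕ} (ψ : Set (Grain d)) : Prop :=
  ∀ K ∈ ψ, ∀ L ∈ ψ, K ≠ L →
    Disjoint (interior (K : Set (Space d))) (interior (L : Set (Space d)))

/-- `ψ` is a locally `h`-maximal thinning of `φ`: it is a hard-core subset of `φ`, and every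
other hard-core subset of `φ` that differs from `ψ` in finitely many grains has a strictly
smaller total `h`-value on the part where they differ. -/
def IsLocallyMaximal {d : ℕ} (h : Grain d → ℝ) (φ ψ : Set (Grain d)) : Prop :=
  ψ ⊆ φ ∧ IsHardCore ψ ∧
    ∀ ψ' : Set (Grain d), ψ' ⊆ φ → IsHardCore ψ' → (symmDiff ψ ψ').Finite → ψ' ≠ ψ →
      ∑ᶠ K ∈ ψ' \ ψ, h K < ∑ᶠ K ∈ ψ \ ψ', h K

/-- `Ψ`, defined on `(Ω, P)`, is a stationary thinning of the particle process `Φ`, defined on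
`(Ω₀, P₀)`, through the measure-preserving map `S : Ω → Ω₀`: almost surely `Ψ` is a subset of
`Φ ∘ S`, and the two processes are jointly stationary. -/
structure IsStationaryThinning {d : ℕ} {Ω₀ Ω : Type*} [MeasurableSpace Ω₀] [MeasurableSpace Ω]
    (P₀ : Measure Ω₀) (Φ : Ω₀ → Config d) (P : Measure Ω) (S : Ω → Ω₀) (Ψ : Ω → Config d) :
    Prop where
  measurable : Measurable Ψ
  measurePreserving : MeasurePreserving S P P₀
  subset : ∀ᵐ ω ∂P, (Ψ ω).grains ⊆ (Φ (S ω)).grains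
  stationary : ∀ x : Space d,
    IdentDistrib (fun ω => ((Φ (S ω)).translate x, (Ψ ω).translate x))
      (fun ω => (Φ (S ω), Ψ ω)) P P

/-- `Ψ` is a locally `h`-maximal particle process with respect to `Φ`: a stationary thinning of
`Φ` which is almost surely a locally `h`-maximal (in particular hard-core) thinning of
`Φ ∘ S`. -/
def IsLocallyMaximalThinning {d : ℕ} {Ω₀ Ω : Type*} [MeasurableSpace Ω₀] [MeasurableSpace Ω]
    (h : Grain d → ℝ) (P₀ : Measure Ω₀) (Φ : Ω₀ → Config d) (P : Measure Ω)
    (Ψ : Ω → Config d) : Prop :=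
  ∃ S : Ω → Ω₀, IsStationaryThinning P₀ Φ P S Ψ ∧
    ∀ᵐ ω ∂P, IsLocallyMaximal h (Φ (S ω)).grains (Ψ ω).grains

/-- The weight `h_a`: a grain gets `exp (a · half its diameter)`, which is `exp (a r)` for a ball
of radius `r`. -/
def expWeight {d : ℕ} (a : ℝ) (K : Grain d) : ℝ :=
  Real.exp (a * (Metric.diam (K : Set (Space d)) / 2))

theorem expWeight_ballGrain {d : ℕ} (hd : 1 ≤ d) (a : ℝ) (x : Space d) {r : ℝ} (hr : 0 ≤ r) :
    expWeight a (ballGrain x r) = Real.exp (a * r) := by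
  have : Nonempty (Fin d) := ⟨⟨0, hd⟩⟩
  rw [expWeight, coe_ballGrain x hr, Metric.diam_closedBall_eq x hr]
  congr 2
  ring

end HardCoreThinning

end

/-!
Two locally maximal thinnings `ψ₁`, `ψ₂` of the same configuration disagree on a union of clusters
of overlapping grains of `symmDiff ψ₁ ψ₂`. A finite cluster is impossible: exchanging the two
thinnings on it would have to decrease the total weight of both of them
(`IsMaximalWithin.eq_empty_of_closed`). So it has to be excluded that such a cluster reaches far.

For large `a`, the weight `exp (a r)` makes the comparison almost lexicographic in the radii. In a
region where no two radii are close, a grain `K` of `ψ₁ \ ψ₂` has to overlap a strictly larger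
grain of `ψ₂ \ ψ₁`, since otherwise it would be profitable to add `K` to `ψ₂` and to remove all the
grains that it overlaps (`exists_larger_of_not_isCrowded`). Repeating this gives a chain of
overlapping grains with increasing radii that cannot stop. Cut the interval `[0, 1)` of radii into
`J₁` blocks. The grains with radius in one block form a subcritical Boolean model, and an
increasing chain visits the blocks one after the other; hence long increasing chains are improbable.
A lattice site is *bad* if in a box around it two radii are close (`IsCrowded`) or if some block
of radii contains a long chain (`IsChained`). Near good sites `ψ₁` and `ψ₂` coincide
(`site_ne_of_not_isBad`).

Badness has finite range, and its probability is as small as desired: the box is chosen large, then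
the threshold for close radii small, which determines `a₀`. By Peierls' argument
(`measure_openPath_le`) there is no long path of bad sites near the origin, except on an event of
small probability (`exists_measure_badPath_le`); and without such a path any two thinnings that
are maximal in a large window agree near the origin (`inter_window_eq_of_no_badPath`).

To pass to distributions, no coupling is needed. The event that some maximal thinning of the
configuration in a large window has a given local property is a measurable event for the Poisson
process (`measurableSet_exists_isMaximalWithin`), and up to small probability it is the
event that a given locally maximal particle process has this local property
(`IsLocallyMaximalThinning.measure_approx`). So all these processes give the same probability to
every local event.
-/

namespace HardCoreThinning

/-! ### Open paths in the lattice -/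

/-- Sites of the lattice `ℤ^d`, with the sup-metric of the product. -/
abbrev Site (d : ℕ) : Type := Fin d → ℤ

/-- The finite set of the sites at sup-distance at most `L` from `z`. -/
noncomputable def box {d : ℕ} (z : Site d) (L : ℕ) : Finset (Site d) :=
  Finset.Icc (fun i => z i - L) (fun i => z i + L)

theorem mem_box {d : ℕ} {z w : Site d} {L : ℕ} : w ∈ box z L ↔ dist z w ≤ L := by
  rw [box, Finset.mem_Icc, dist_pi_le_iff (by positivity), Pi.le_def, Pi.le_def, ← forall_and]
  refine forall_congr' fun i => ?_
  rw [Int.dist_eq, abs_le]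
  constructor
  · rintro ⟨h1, h2⟩
    have h1' : ((z i - L : ℤ) : ℝ) ≤ w i := by exact_mod_cast h1
    have h2' : (w i : ℝ) ≤ ((z i + L : ℤ) : ℝ) := by exact_mod_cast h2
    push_cast at h1' h2'
    constructor <;> linarith
  · rintro ⟨h1, h2⟩
    have h1' : ((z i - L : ℤ) : ℝ) ≤ w i := by push_cast; linarith
    have h2' : (w i : ℝ) ≤ ((z i + L : ℤ) : ℝ) := by push_cast; linarith
    exact ⟨by exact_mod_cast h1', by exact_mod_cast h2'⟩

theorem card_box {d : ℕ} (z : Site d) (L : ℕ) : (box z L).card = (2 * L + 1) ^ d := by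
  rw [box, Pi.card_Icc]
  simp only [Int.card_Icc]
  have h : ∀ i, (z i + L + 1 - (z i - L)).toNat = 2 * L + 1 := fun i => by omega
  simp only [h, Finset.prod_const, Finset.card_univ, Fintype.card_fin]

/-- `v` can be reached from `u` by steps of length at most `s` all of whose endpoints, except
possibly the starting point `u`, lie in the set `E` of open sites. -/
def OpenPath {d : ℕ} (s : ℕ) (E : Set (Site d)) : Site d → Site d → Prop :=
  Relation.ReflTransGen (fun u v => dist u v ≤ s ∧ v ∈ E)

theorem OpenPath.mono {d s : ℕ} {E F : Set (Site d)} (hEF : E ⊆ F) {u v : Site d}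
    (h : OpenPath s E u v) : OpenPath s F u v :=
  Relation.ReflTransGen.mono (fun _ _ h => ⟨h.1, hEF h.2⟩) _ _ h

/-- Last exit from a ball: the part of an open path after its last visit to the ball of radius
`m` about its starting point. -/
theorem OpenPath.exists_last_exit {d s m : ℕ} (hm : 0 < m) {E : Set (Site d)} {u v : Site d}
    (h : OpenPath s E u v) (hv : (m : ℝ) ≤ dist u v) :
    ∃ w ∈ {x ∈ E | (m : ℝ) ≤ dist u x}, dist u w ≤ m + s ∧
      OpenPath s {x ∈ E | (m : ℝ) ≤ dist u x} w v := by
  induction h with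
  | refl =>
    rw [dist_self] at hv
    exact absurd hv (by simpa using hm.ne')
  | tail hub hbc ih =>
    rename_i b c
    by_cases hb : (m : ℝ) ≤ dist u b
    · obtain ⟨w, hw, hd, hp⟩ := ih hb
      exact ⟨w, hw, hd, hp.tail ⟨hbc.1, hbc.2, hv⟩⟩
    · refine ⟨c, ⟨hbc.2, hv⟩, ?_, .refl⟩
      have := dist_triangle u b c
      linarith [hbc.1, not_le.1 hb]

/-- The finite set of the walks with `k` steps that start at `u`, with steps of length at most
`t`, as lists of sites. -/
noncomputable def walks {d : ℕ} (t : ℕ) : ℕ → Site d → Finset (List (Site d))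
  | 0, u => {[u]}
  | k + 1, u => (box u t).biUnion fun w => (walks t k w).image (List.cons u)

theorem card_walks_le {d : ℕ} (t k : ℕ) (u : Site d) :
    (walks t k u).card ≤ ((2 * t + 1) ^ d) ^ k := by
  induction k generalizing u with
  | zero => simp [walks]
  | succ k ih =>
    rw [walks]
    refine (Finset.card_biUnion_le_card_mul _ _ _
      (fun w _ => Finset.card_image_le.trans (ih w))).trans ?_
    rw [card_box, pow_succ' _ k]

theorem length_of_mem_walks {d t k : ℕ} {u : Site d} {l : List (Site d)}
    (hl : l ∈ walks t k u) : l.length = k + 1 := by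
  induction k generalizing u l with
  | zero => simp_all [walks]
  | succ k ih =>
    simp only [walks, Finset.mem_biUnion, Finset.mem_image] at hl
    obtain ⟨w, -, l', hl', rfl⟩ := hl
    simp [ih hl']

/-- A long open path contains a long walk of open sites that are pairwise at distance at least
`m` and whose steps have length at most `m + s`: iterate the last exit decomposition. -/
theorem OpenPath.exists_separated_walk {d s m : ℕ} (hm : 0 < m) (k : ℕ) {E : Set (Site d)}
    {u v : Site d} (hu : u ∈ E) (h : OpenPath s E u v)
    (hv : (k : ℝ) * (m + s) ≤ dist u v) :
    ∃ l ∈ walks (m + s) k u, l.Pairwise (fun x y => (m : ℝ) ≤ dist x y) ∧ ∀ x ∈ l, x ∈ E := by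
  induction k generalizing E u with
  | zero => exact ⟨[u], by simp [walks], by simp, by simpa using hu⟩
  | succ k ih =>
    push_cast at hv
    have hk : (0 : ℝ) ≤ k * (m + s) := by positivity
    obtain ⟨w, hw, hd, hp⟩ := h.exists_last_exit hm (by nlinarith [s.cast_nonneg (α := ℝ)])
    obtain ⟨l, hl, hpair, hE⟩ := ih hw hp (by linarith [dist_triangle u w v])
    refine ⟨u :: l, ?_, ?_, ?_⟩
    · simp only [walks, Finset.mem_biUnion, Finset.mem_image]
      exact ⟨w, mem_box.2 (by push_cast; exact hd), l, hl, rfl⟩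
    · exact List.pairwise_cons.2 ⟨fun x hx => (hE x hx).2, hpair⟩
    · intro x hx
      rcases List.mem_cons.1 hx with rfl | hx
      · exact hu
      · exact (hE x hx).1

/-- Peierls' estimate: if separated sites are simultaneously open with at most the product
probability, then a long open path starting at `u` has exponentially small probability. -/
theorem measure_openPath_le {d s m : ℕ} (hm : 0 < m) {Ω : Type*} [MeasurableSpace Ω]
    (μ : Measure Ω) (E : Ω → Set (Site d)) (p : ENNReal)
    (hp : ∀ l : List (Site d), l.Pairwise (fun x y => (m : ℝ) ≤ dist x y) →
      μ {ω | ∀ x ∈ l, x ∈ E ω} ≤ p ^ l.length) (k : ℕ) (u : Site d) :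
    μ {ω | u ∈ E ω ∧ ∃ v, OpenPath s (E ω) u v ∧ (k : ℝ) * (m + s) ≤ dist u v} ≤
      (((2 * (m + s) + 1) ^ d : ℕ) * p) ^ k * p := by
  classical
  set W := (walks (m + s) k u).filter
    (fun l => l.Pairwise (fun x y => (m : ℝ) ≤ dist x y)) with hW
  calc _ ≤ μ (⋃ l ∈ W, {ω | ∀ x ∈ l, x ∈ E ω}) := by
        refine measure_mono ?_
        rintro ω ⟨hu, v, hpath, hv⟩
        obtain ⟨l, hl, hpair, hE⟩ := hpath.exists_separated_walk hm k hu hv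
        simp only [mem_iUnion]
        exact ⟨l, Finset.mem_filter.2 ⟨hl, hpair⟩, hE⟩
    _ ≤ ∑ l ∈ W, μ {ω | ∀ x ∈ l, x ∈ E ω} := measure_biUnion_finset_le _ _
    _ ≤ ∑ l ∈ W, p ^ (k + 1) := by
        refine Finset.sum_le_sum fun l hl => ?_
        obtain ⟨hl, hpair⟩ := Finset.mem_filter.1 hl
        rw [← length_of_mem_walks hl]
        exact hp l hpair
    _ ≤ (((2 * (m + s) + 1) ^ d) ^ k : ℕ) * p ^ (k + 1) := by
        rw [Finset.sum_const, nsmul_eq_mul]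
        gcongr
        exact (Finset.card_filter_le _ _).trans (card_walks_le _ _ _)
    _ = _ := by push_cast; ring

/-! ### Events that depend on disjoint sets of coordinates -/

theorem iIndepFun_of_fin {Ω ι β : Type*} [MeasurableSpace Ω] [MeasurableSpace β]
    {μ : Measure Ω} {X : ι → Ω → β}
    (h : ∀ (n : ℕ) (g : Fin n → ι), Function.Injective g → iIndepFun (fun i => X (g i)) μ) :
    iIndepFun X μ := by
  rw [iIndepFun_iff_finset]
  intro s
  have := h s.card (fun i => (s.equivFin.symm i : ι))
    (Subtype.val_injective.comp s.equivFin.symm.injective)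
  have h2 := this.precomp s.equivFin.injective
  convert h2 using 2 with i
  simp [Finset.restrict]

/-- Two events that depend on disjoint finite sets of independent discrete coordinates are
independent. -/
theorem measure_and_of_dependsOn {Ω ι : Type*} [MeasurableSpace Ω] {μ : Measure Ω}
    {X : ι → Ω → ℕ∞} (hX : ∀ i, Measurable (X i)) (hind : iIndepFun X μ)
    {F G : Finset ι} (hFG : Disjoint F G) {E D : (ι → ℕ∞) → Prop}
    (hE : DependsOn E (F : Set ι)) (hD : DependsOn D (G : Set ι)) :
    μ {ω | E (fun i => X i ω) ∧ D (fun i => X i ω)} =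
      μ {ω | E (fun i => X i ω)} * μ {ω | D (fun i => X i ω)} := by
  classical
  -- the event as the preimage of a set of values of the finitely many coordinates
  have key : ∀ (H : Finset ι) (C : (ι → ℕ∞) → Prop), DependsOn C (H : Set ι) →
      ∃ B : Set (H → ℕ∞), {ω | C (fun i => X i ω)} = (fun ω (i : H) => X i ω) ⁻¹' B := by
    intro H C hC
    refine ⟨{y | C (fun i => if h : i ∈ H then y ⟨i, h⟩ else 0)}, ?_⟩
    ext ω
    simp only [mem_ofPred_eq, mem_preimage]
    refine iff_of_eq (hC fun i hi => ?_)
    rw [dif_pos (Finset.mem_coe.1 hi)]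
  obtain ⟨B, hB⟩ := key F E hE
  obtain ⟨B', hB'⟩ := key G D hD
  have := (hind.indepFun_finset F G hFG hX).measure_inter_preimage_eq_mul B B'
    (to_countable B).measurableSet (to_countable B').measurableSet
  rwa [← hB, ← hB'] at this

/-- Events that depend on pairwise disjoint finite sets of independent discrete coordinates
satisfy the product bound. -/
theorem measure_forall_mem_le_pow {Ω ι S : Type*} [MeasurableSpace Ω] {μ : Measure Ω}
    {X : ι → Ω → ℕ∞} (hX : ∀ i, Measurable (X i)) (hind : iIndepFun X μ)
    (F : S → Finset ι) (E : S → (ι → ℕ∞) → Prop)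
    (hE : ∀ z, DependsOn (E z) (F z : Set ι)) (p : ENNReal)
    (hp : ∀ z, μ {ω | E z (fun i => X i ω)} ≤ p) (l : List S)
    (hl : l.Pairwise fun x y => Disjoint (F x) (F y)) :
    μ {ω | ∀ x ∈ l, E x (fun i => X i ω)} ≤ p ^ l.length := by
  classical
  have hprob : IsProbabilityMeasure μ := hind.isProbabilityMeasure
  induction l with
  | nil => simp
  | cons z l ih =>
    obtain ⟨hz, hl⟩ := List.pairwise_cons.1 hl
    have hdep : DependsOn (fun x : ι → ℕ∞ => ∀ w ∈ l, E w x)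
        ((l.toFinset.biUnion F : Finset ι) : Set ι) := by
      intro x y hxy
      refine propext (forall₂_congr fun w hw => iff_of_eq (hE w fun i hi => hxy i ?_))
      rw [Finset.mem_coe, Finset.mem_biUnion]
      exact ⟨w, List.mem_toFinset.2 hw, hi⟩
    have hdisj : Disjoint (F z) (l.toFinset.biUnion F) :=
      (Finset.disjoint_biUnion_right _ _ _).2 fun w hw => hz w (List.mem_toFinset.1 hw)
    have := measure_and_of_dependsOn hX hind hdisj (hE z) hdep
    simp only [List.forall_mem_cons, List.length_cons]
    rw [this, pow_succ']
    exact mul_le_mul' (hp z) (ih hl)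

/-! ### Balls, their centres and radii -/

theorem center_eq_of_closedBall_eq {d : ℕ} {x y : Space d} {r : ℝ} (hr : 0 ≤ r)
    (h : Metric.closedBall x r = Metric.closedBall y r) : x = y := by
  by_contra hxy
  have hpos : 0 < ‖x - y‖ := norm_pos_iff.2 (sub_ne_zero.2 hxy)
  -- the point of the ball about `x` that is farthest from `y`
  have hmem : x + (r / ‖x - y‖) • (x - y) ∈ Metric.closedBall x r := by
    rw [mem_closedBall_iff_norm, add_sub_cancel_left, norm_smul, Real.norm_eq_abs,
      abs_of_nonneg (by positivity), div_mul_cancel₀ _ hpos.ne']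
  rw [h, mem_closedBall_iff_norm] at hmem
  have heq : x + (r / ‖x - y‖) • (x - y) - y = (1 + r / ‖x - y‖) • (x - y) := by
    rw [add_smul, one_smul]; abel
  rw [heq, norm_smul, Real.norm_eq_abs, abs_of_nonneg (by positivity), add_mul,
    div_mul_cancel₀ _ hpos.ne'] at hmem
  linarith

/-- Half the diameter of a grain; the radius if the grain is a ball and `d ≥ 1`. -/
noncomputable def radius {d : ℕ} (K : Grain d) : ℝ := Metric.diam (K : Set (Space d)) / 2

theorem radius_ballGrain {d : ℕ} (hd : 1 ≤ d) (x : Space d) {r : ℝ} (hr : 0 ≤ r) :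
    radius (ballGrain x r) = r := by
  have : Nonempty (Fin d) := ⟨⟨0, hd⟩⟩
  rw [radius, coe_ballGrain x hr, Metric.diam_closedBall_eq x hr]
  ring

open Classical in
/-- The centre of a grain that is a ball; the origin for all other grains. -/
noncomputable def center {d : ℕ} (K : Grain d) : Space d :=
  if h : ∃ x : Space d, ∃ r : ℝ, 0 ≤ r ∧ K = ballGrain x r then h.choose else 0

theorem center_ballGrain {d : ℕ} (hd : 1 ≤ d) (x : Space d) {r : ℝ} (hr : 0 ≤ r) :
    center (ballGrain x r) = x := by
  have h : ∃ y : Space d, ∃ s : ℝ, 0 ≤ s ∧ ballGrain x r = ballGrain y s := ⟨x, r, hr, rfl⟩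
  rw [center, dif_pos h]
  obtain ⟨s, hs, heq⟩ := h.choose_spec
  have hrs : r = s := by
    rw [← radius_ballGrain hd x hr, heq, radius_ballGrain hd _ hs]
  subst hrs
  have := congrArg (fun K : Grain d => (K : Set (Space d))) heq
  simp only [coe_ballGrain _ hr] at this
  exact (center_eq_of_closedBall_eq hr this).symm

/-- The balls with radius in `[0, 1)`; almost surely, all grains of the Boolean model are of
this kind. -/
def unitBalls (d : ℕ) : Set (Grain d) :=
  {K | ∃ x : Space d, ∃ r : ℝ, 0 ≤ r ∧ r < 1 ∧ K = ballGrain x r}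

/-- The grains in `unitBalls d` with centre and radius in `T`. -/
def ballsIn {d : ℕ} (T : Set (Space d × ℝ)) : Set (Grain d) :=
  {K ∈ unitBalls d | (center K, radius K) ∈ T}

theorem ballGrain_mem_ballsIn {d : ℕ} (hd : 1 ≤ d) {T : Set (Space d × ℝ)} {x : Space d} {r : ℝ}
    (hr : 0 ≤ r) : ballGrain x r ∈ ballsIn T ↔ r < 1 ∧ (x, r) ∈ T := by
  simp only [ballsIn, mem_ofPred_eq, center_ballGrain hd x hr, radius_ballGrain hd x hr]
  refine and_congr_left fun _ => ⟨?_, fun h => ⟨x, r, hr, h, rfl⟩⟩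
  rintro ⟨y, s, hs, hs1, h⟩
  rwa [← radius_ballGrain hd x hr, h, radius_ballGrain hd y hs]

theorem ballsIn_eq_image {d : ℕ} (hd : 1 ≤ d) (T : Set (Space d × ℝ)) :
    ballsIn T = (fun p : Space d × ℝ => ballGrain p.1 p.2) '' (T ∩ univ ×ˢ Ico 0 1) := by
  ext K
  constructor
  · rintro ⟨⟨x, r, hr, hr1, rfl⟩, hT⟩
    rw [center_ballGrain hd x hr, radius_ballGrain hd x hr] at hT
    exact ⟨(x, r), ⟨hT, mem_univ _, hr, hr1⟩, rfl⟩
  · rintro ⟨⟨x, r⟩, ⟨hT, -, hr, hr1⟩, rfl⟩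
    exact (ballGrain_mem_ballsIn hd hr).2 ⟨hr1, hT⟩

theorem measurableSet_ballsIn {d : ℕ} (hd : 1 ≤ d) {T : Set (Space d × ℝ)}
    (hT : MeasurableSet T) : MeasurableSet (ballsIn T) := by
  rw [ballsIn_eq_image hd]
  refine (hT.inter (MeasurableSet.univ.prod measurableSet_Ico)).image_of_continuousOn_injOn
    (continuous_ballGrain d).continuousOn ?_
  rintro ⟨x, r⟩ ⟨-, -, hr, -⟩ ⟨y, s⟩ ⟨-, -, hs, -⟩ h
  have h1 := congrArg center h
  have h2 := congrArg radius h
  simp only [center_ballGrain hd _ hr, center_ballGrain hd _ hs] at h1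
  simp only [radius_ballGrain hd _ hr, radius_ballGrain hd _ hs] at h2
  rw [h1, h2]

theorem ballsIn_univ (d : ℕ) : ballsIn univ = unitBalls d := by
  ext K
  simp [ballsIn]

theorem measurableSet_unitBalls {d : ℕ} (hd : 1 ≤ d) : MeasurableSet (unitBalls d) :=
  ballsIn_univ d ▸ measurableSet_ballsIn hd MeasurableSet.univ

theorem booleanIntensity_ballsIn_le {d : ℕ} (hd : 1 ≤ d) (γ₀ : ℝ) {T : Set (Space d × ℝ)}
    (hT : MeasurableSet T) : booleanIntensity d γ₀ (ballsIn T) ≤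
      ((ENNReal.ofReal γ₀ • (volume : Measure (Space d))).prod
        ((volume : Measure ℝ).restrict (Icc 0 1))) T := by
  rw [booleanIntensity, Measure.map_apply (measurable_ballGrain d) (measurableSet_ballsIn hd hT)]
  refine measure_mono_ae ?_
  have h : ∀ᵐ p : Space d × ℝ ∂((ENNReal.ofReal γ₀ • (volume : Measure (Space d))).prod
        ((volume : Measure ℝ).restrict (Icc 0 1))), p.2 ∈ Icc (0 : ℝ) 1 :=
    Measure.quasiMeasurePreserving_snd.ae (ae_restrict_mem measurableSet_Icc)
  filter_upwards [h] with p hp hpT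
  exact ((ballGrain_mem_ballsIn hd hp.1).1 hpT).2

theorem booleanIntensity_compl_unitBalls {d : ℕ} (hd : 1 ≤ d) (γ₀ : ℝ) :
    booleanIntensity d γ₀ (unitBalls d)ᶜ = 0 := by
  rw [booleanIntensity, Measure.map_apply (measurable_ballGrain d)
    (measurableSet_unitBalls hd).compl]
  have h : ∀ᵐ p : Space d × ℝ ∂((ENNReal.ofReal γ₀ • (volume : Measure (Space d))).prod
        ((volume : Measure ℝ).restrict (Icc 0 1))), p.2 ∈ Ico (0 : ℝ) 1 := by
    refine Measure.quasiMeasurePreserving_snd.ae (p := fun r => r ∈ Ico (0 : ℝ) 1) ?_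
    rw [← Measure.restrict_congr_set Ico_ae_eq_Icc]
    exact ae_restrict_mem measurableSet_Ico
  refine (ae_iff.1 (h.mono fun p hp => ?_) : _ = _)
  exact ⟨p.1, p.2, hp.1, hp.2, rfl⟩

/-! ### Cells -/

/-- The lattice site of a grain: the unit cube that contains its centre. -/
noncomputable def site {d : ℕ} (K : Grain d) : Site d := fun i => ⌊center K i⌋

/-- The level of a grain: the index of the interval `[ρ/J, (ρ+1)/J)` that contains its radius. -/
noncomputable def level {d : ℕ} (J : ℕ) (K : Grain d) : ℕ := ⌊J * radius K⌋₊

/-- The grains in `unitBalls d` with prescribed site and level. -/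
def cell {d : ℕ} (J : ℕ) (i : Site d × ℕ) : Set (Grain d) :=
  {K ∈ unitBalls d | site K = i.1 ∧ level J K = i.2}

theorem cell_eq_ballsIn {d : ℕ} (J : ℕ) (i : Site d × ℕ) :
    cell J i = ballsIn ({x : Space d | ∀ j, ⌊x j⌋ = i.1 j} ×ˢ {r : ℝ | ⌊J * r⌋₊ = i.2}) := by
  ext K
  simp [cell, ballsIn, site, level, funext_iff]

theorem measurableSet_cube {d : ℕ} (y : Site d) :
    MeasurableSet {x : Space d | ∀ j, ⌊x j⌋ = y j} := by
  have : {x : Space d | ∀ j, ⌊x j⌋ = y j} = ⋂ j, {x : Space d | ⌊x j⌋ = y j} := by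
    ext; simp
  rw [this]
  refine MeasurableSet.iInter fun j => ?_
  have : Measurable fun x : Space d => ⌊x j⌋ := by fun_prop
  exact this (measurableSet_singleton (y j))

theorem volume_cube {d : ℕ} (y : Site d) :
    (volume : Measure (Space d)) {x : Space d | ∀ j, ⌊x j⌋ = y j} = 1 := by
  have h : {x : Space d | ∀ j, ⌊x j⌋ = y j} =
      (MeasurableEquiv.toLp 2 (Fin d → ℝ)).symm ⁻¹'
        (univ.pi fun j => Ico (y j : ℝ) (y j + 1)) := by
    ext x
    simp [Int.floor_eq_iff]
  rw [h, (EuclideanSpace.volume_preserving_symm_measurableEquiv_toLp (Fin d)).measure_preimage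
    (MeasurableSet.univ_pi fun j => measurableSet_Ico).nullMeasurableSet, volume_pi_pi]
  simp

theorem measurableSet_levelInterval (J ρ : ℕ) : MeasurableSet {r : ℝ | ⌊(J : ℝ) * r⌋₊ = ρ} := by
  have : Measurable fun r : ℝ => ⌊(J : ℝ) * r⌋₊ := by fun_prop
  exact this (measurableSet_singleton ρ)

theorem measurableSet_cell {d : ℕ} (hd : 1 ≤ d) (J : ℕ) (i : Site d × ℕ) :
    MeasurableSet (cell J i) := by
  rw [cell_eq_ballsIn]
  exact measurableSet_ballsIn hd ((measurableSet_cube _).prod (measurableSet_levelInterval _ _))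

theorem booleanIntensity_cell_le {d : ℕ} (hd : 1 ≤ d) (γ₀ : ℝ) {J : ℕ} (hJ : 0 < J)
    (i : Site d × ℕ) : booleanIntensity d γ₀ (cell J i) ≤ ENNReal.ofReal (γ₀ / J) := by
  rw [cell_eq_ballsIn]
  refine (booleanIntensity_ballsIn_le hd γ₀
    ((measurableSet_cube _).prod (measurableSet_levelInterval _ _))).trans ?_
  have hJ' : (0 : ℝ) < J := by exact_mod_cast hJ
  have h : ((volume : Measure ℝ).restrict (Icc 0 1)) {r : ℝ | ⌊(J : ℝ) * r⌋₊ = i.2} ≤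
      ENNReal.ofReal (1 / J) := by
    rw [Measure.restrict_apply (measurableSet_levelInterval _ _)]
    calc _ ≤ volume (Icc ((i.2 : ℝ) / J) ((i.2 + 1) / J)) := by
          refine measure_mono ?_
          rintro r ⟨hr, hr0, -⟩
          have := (Nat.floor_eq_iff (by positivity)).1 hr
          rw [mem_Icc, div_le_iff₀ hJ', le_div_iff₀ hJ']
          constructor <;> linarith
      _ = _ := by
          rw [Real.volume_Icc]
          congr 1
          ring
  rw [Measure.prod_prod, Measure.smul_apply, volume_cube, smul_eq_mul, mul_one,
    div_eq_mul_one_div, ENNReal.ofReal_mul' (by positivity)]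
  gcongr

theorem pairwise_disjoint_cell {d : ℕ} (J : ℕ) :
    Pairwise fun i j : Site d × ℕ => Disjoint (cell J i) (cell J j) := by
  intro i j hij
  refine Set.disjoint_left.2 fun K hi hj => hij ?_
  exact Prod.ext (hi.2.1.symm.trans hj.2.1) (hi.2.2.symm.trans hj.2.2)

/-- Grains with overlapping interiors have nearby sites. -/
theorem dist_site_le_two {d : ℕ} (hd : 1 ≤ d) {K L : Grain d} (hK : K ∈ unitBalls d)
    (hL : L ∈ unitBalls d)
    (h : ¬ Disjoint (interior (K : Set (Space d))) (interior (L : Set (Space d)))) :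
    dist (site K) (site L) ≤ 2 := by
  obtain ⟨x, r, hr, hr1, rfl⟩ := hK
  obtain ⟨y, s, hs, hs1, rfl⟩ := hL
  obtain ⟨z, hzK, hzL⟩ := Set.not_disjoint_iff.1 h
  have hx := interior_subset hzK
  have hy := interior_subset hzL
  rw [coe_ballGrain _ hr, Metric.mem_closedBall] at hx
  rw [coe_ballGrain _ hs, Metric.mem_closedBall] at hy
  have hxy : dist x y < 2 := by
    have := dist_triangle_left x y z
    linarith
  rw [dist_pi_le_iff (by norm_num)]
  intro i
  simp only [site, center_ballGrain hd x hr, center_ballGrain hd y hs]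
  have hi : |x i - y i| < 2 := by
    have := PiLp.norm_apply_le (x - y) i
    rw [← dist_eq_norm, Real.norm_eq_abs] at this
    exact this.trans_lt hxy
  rw [abs_lt] at hi
  have h1 := Int.floor_le (x i)
  have h2 := Int.lt_floor_add_one (x i)
  have h3 := Int.floor_le (y i)
  have h4 := Int.lt_floor_add_one (y i)
  have h5 : ⌊x i⌋ < ⌊y i⌋ + 3 := by
    have : (⌊x i⌋ : ℝ) < ((⌊y i⌋ + 3 : ℤ) : ℝ) := by push_cast; linarith
    exact_mod_cast this
  have h6 : ⌊y i⌋ < ⌊x i⌋ + 3 := by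
    have : (⌊y i⌋ : ℝ) < ((⌊x i⌋ + 3 : ℤ) : ℝ) := by push_cast; linarith
    exact_mod_cast this
  rw [Int.dist_eq]
  have h7 : |⌊x i⌋ - ⌊y i⌋| ≤ 2 := abs_le.2 ⟨by omega, by omega⟩
  exact_mod_cast h7

/-- The grains in `unitBalls d` whose site is at distance at most `n` from the origin. -/
def window (d n : ℕ) : Set (Grain d) := {K ∈ unitBalls d | site K ∈ box 0 n}

theorem measurableSet_window {d : ℕ} (hd : 1 ≤ d) (n : ℕ) : MeasurableSet (window d n) := by
  have : window d n =
      ⋃ y ∈ box (0 : Site d) n, ballsIn ({x : Space d | ∀ j, ⌊x j⌋ = y j} ×ˢ univ) := by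
    ext K
    simp only [window, ballsIn, mem_ofPred_eq, mem_iUnion, mem_prod, mem_univ, and_true]
    constructor
    · rintro ⟨hK, hb⟩
      exact ⟨site K, hb, hK, fun j => rfl⟩
    · rintro ⟨y, hy, hK, hj⟩
      exact ⟨hK, (funext hj : site K = y) ▸ hy⟩
  rw [this]
  exact Finset.measurableSet_biUnion _ fun y _ =>
    measurableSet_ballsIn hd ((measurableSet_cube y).prod MeasurableSet.univ)

theorem finite_inter_window {d : ℕ} (hd : 1 ≤ d) {φ : Set (Grain d)} (hφ : IsLocallyFinite φ)
    (n : ℕ) : (φ ∩ window d n).Finite := by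
  -- the centres of the grains in the window lie in a compact box
  let C : Set (Space d) :=
    (MeasurableEquiv.toLp 2 (Fin d → ℝ)) '' (Icc (fun _ => -(n : ℝ)) (fun _ => (n : ℝ) + 1))
  have hC : IsCompact C := isCompact_Icc.image (PiLp.continuous_toLp 2 _)
  refine (hφ C hC).subset ?_
  rintro K ⟨hKφ, ⟨x, r, hr, hr1, rfl⟩, hb⟩
  refine ⟨hKφ, x, ?_, WithLp.ofLp x, ?_, rfl⟩
  · rw [coe_ballGrain x hr]
    exact Metric.mem_closedBall_self hr
  · rw [box, Finset.mem_Icc] at hb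
    obtain ⟨h1, h2⟩ := hb
    constructor <;> intro i
    · have := h1 i
      simp only [site, center_ballGrain hd x hr, Pi.zero_apply, zero_sub] at this
      have := Int.le_floor.1 this
      push_cast at this
      exact this
    · have := h2 i
      simp only [site, center_ballGrain hd x hr, Pi.zero_apply, zero_add] at this
      have h3 : (⌊x i⌋ : ℝ) ≤ n := by exact_mod_cast this
      have h4 := Int.lt_floor_add_one (x i)
      change x i ≤ n + 1
      linarith

/-! ### Counting variables of a Poisson process -/

theorem measurable_count {d : ℕ} {B : Set (Grain d)} (hB : MeasurableSet B) :
    Measurable (Config.count B : Config d → ℕ∞) :=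
  Measurable.of_comap_le (le_iSup (fun B : {B : Set (Grain d) // MeasurableSet B} =>
    MeasurableSpace.comap (Config.count B.1) inferInstance) ⟨B, hB⟩)

theorem IsPoissonProcess.measurable_count {d : ℕ} {Ω : Type*} [MeasurableSpace Ω]
    {P : Measure Ω} {Λ : Measure (Grain d)} {Φ : Ω → Config d} (h : IsPoissonProcess P Λ Φ)
    {B : Set (Grain d)} (hB : MeasurableSet B) : Measurable fun ω => (Φ ω).count B :=
  (HardCoreThinning.measurable_count hB).comp h.measurable

theorem IsPoissonProcess.measure_count_eq {d : ℕ} {Ω : Type*} [MeasurableSpace Ω]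
    {P : Measure Ω} {Λ : Measure (Grain d)} {Φ : Ω → Config d}
    (h : IsPoissonProcess P Λ Φ) {B : Set (Grain d)} (hB : MeasurableSet B) (hΛ : Λ B ≠ ⊤)
    (n : ℕ) : P {ω | (Φ ω).count B = n} =
      ENNReal.ofReal (Real.exp (-(Λ B).toReal) * (Λ B).toReal ^ n / n.factorial) := by
  rw [h.poisson B hB hΛ, poissonMeasure_singleton]
  rfl

theorem IsPoissonProcess.measure_count_ne_zero_le {d : ℕ} {Ω : Type*} [MeasurableSpace Ω]
    {P : Measure Ω} [IsProbabilityMeasure P] {Λ : Measure (Grain d)} {Φ : Ω → Config d}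
    (h : IsPoissonProcess P Λ Φ) {B : Set (Grain d)} (hB : MeasurableSet B) (hΛ : Λ B ≠ ⊤) :
    P {ω | (Φ ω).count B ≠ 0} ≤ Λ B := by
  have h0 := h.measure_count_eq hB hΛ 0
  have hm : MeasurableSet {ω | (Φ ω).count B = 0} := h.measurable_count hB (measurableSet_singleton 0)
  have : {ω | (Φ ω).count B ≠ 0} = {ω | (Φ ω).count B = 0}ᶜ := rfl
  rw [this, prob_compl_eq_one_sub hm]
  simp only [Nat.cast_zero, pow_zero, mul_one, Nat.factorial_zero, Nat.cast_one, div_one] at h0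
  rw [h0, ← ENNReal.ofReal_one, ← ENNReal.ofReal_sub _ (Real.exp_nonneg _)]
  refine (ENNReal.ofReal_le_ofReal ?_).trans_eq (ENNReal.ofReal_toReal hΛ)
  linarith [Real.add_one_le_exp (-(Λ B).toReal)]

theorem IsPoissonProcess.measure_two_le_count_le {d : ℕ} {Ω : Type*} [MeasurableSpace Ω]
    {P : Measure Ω} [IsProbabilityMeasure P] {Λ : Measure (Grain d)} {Φ : Ω → Config d}
    (h : IsPoissonProcess P Λ Φ) {B : Set (Grain d)} (hB : MeasurableSet B) (hΛ : Λ B ≠ ⊤) :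
    P {ω | 2 ≤ (Φ ω).count B} ≤ Λ B ^ 2 := by
  have h0 := h.measure_count_eq hB hΛ 0
  have h1 := h.measure_count_eq hB hΛ 1
  have hm0 : MeasurableSet {ω | (Φ ω).count B = 0} :=
    h.measurable_count hB (measurableSet_singleton 0)
  have hm1 : MeasurableSet {ω | (Φ ω).count B = 1} :=
    h.measurable_count hB (measurableSet_singleton 1)
  have hdisj : Disjoint {ω | (Φ ω).count B = 0} {ω | (Φ ω).count B = 1} := by
    refine Set.disjoint_left.2 fun ω h h' => ?_
    rw [mem_ofPred_eq] at h h'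
    rw [h] at h'
    exact zero_ne_one h'
  have : {ω | 2 ≤ (Φ ω).count B} = ({ω | (Φ ω).count B = 0} ∪ {ω | (Φ ω).count B = 1})ᶜ := by
    ext ω
    simp only [mem_ofPred_eq, mem_compl_iff, mem_union, not_or]
    generalize (Φ ω).count B = c
    induction c using ENat.recTopCoe with
    | top => simp
    | coe n =>
      norm_cast
      omega
  rw [this, prob_compl_eq_one_sub (hm0.union hm1), measure_union hdisj hm1]
  simp only [Nat.cast_zero, pow_zero, mul_one, Nat.factorial_zero, Nat.cast_one, div_one,
    pow_one, Nat.factorial_one] at h0 h1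
  set t := (Λ B).toReal with ht
  have ht0 : 0 ≤ t := ENNReal.toReal_nonneg
  rw [h0, h1, ← ENNReal.ofReal_add (by positivity) (by positivity), ← ENNReal.ofReal_one,
    ← ENNReal.ofReal_sub _ (by positivity)]
  have hΛ' : Λ B ^ 2 = ENNReal.ofReal (t ^ 2) := by
    rw [ENNReal.ofReal_pow ht0, ENNReal.ofReal_toReal hΛ]
  rw [hΛ']
  refine ENNReal.ofReal_le_ofReal ?_
  nlinarith [Real.add_one_le_exp (-t)]

theorem count_biUnion {d : ℕ} {ι : Type*} {B : ι → Set (Grain d)}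
    (hB : Pairwise fun i j => Disjoint (B i) (B j)) (F : Finset ι) (φ : Config d) :
    φ.count (⋃ i ∈ F, B i) = ∑ i ∈ F, φ.count (B i) := by
  classical
  induction F using Finset.induction_on with
  | empty => simp [Config.count]
  | insert i F hi ih =>
    rw [Finset.sum_insert hi, ← ih, Finset.set_biUnion_insert, Config.count, inter_union_distrib_left,
      Set.encard_union_eq]
    · rfl
    · refine Disjoint.mono inter_subset_right inter_subset_right ?_
      rw [Set.disjoint_iUnion₂_right]
      intro j hj
      exact hB fun h => hi (h ▸ hj)

/-! ### Bad sites -/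

/-- The numbers of grains in the cells. -/
noncomputable def cellCounts {d : ℕ} (J : ℕ) (φ : Config d) : Site d × ℕ → ℕ∞ :=
  fun i => φ.count (cell J i)

/-- Among the grains with sites near `z`, two have equal or adjacent levels. -/
def IsCrowded {d : ℕ} (J L : ℕ) (z : Site d) (x : Site d × ℕ → ℕ∞) : Prop :=
  ∃ ρ < J, 2 ≤ ∑ i ∈ box z L ×ˢ {ρ, ρ + 1}, x i

/-- The sites with a grain whose level belongs to the `q`-th block of `M` consecutive levels. -/
def occupied {d : ℕ} (M q : ℕ) (x : Site d × ℕ → ℕ∞) : Set (Site d) :=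
  {u | ∃ ρ, ρ / M = q ∧ x (u, ρ) ≠ 0}

/-- Near `z`, and within one of the first `J₁` blocks of levels, the occupied sites form a path
of extent at least `3 * k`. -/
def IsChained {d : ℕ} (J₁ M L k : ℕ) (z : Site d) (x : Site d × ℕ → ℕ∞) : Prop :=
  ∃ q < J₁, ∃ u ∈ occupied M q x ∩ box z L, ∃ v,
    OpenPath 2 (occupied M q x ∩ box z L) u v ∧ (k : ℝ) * 3 ≤ dist u v

/-- A site around which the configuration may fail to be determined locally. The levels
`0, …, J₁ * M - 1` are grouped into `J₁` blocks. -/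
def IsBad {d : ℕ} (J₁ M L k : ℕ) (z : Site d) (x : Site d × ℕ → ℕ∞) : Prop :=
  IsCrowded (J₁ * M) L z x ∨ IsChained J₁ M L k z x

theorem dependsOn_isBad {d : ℕ} {J₁ M : ℕ} (hM : 0 < M) (L k : ℕ) (z : Site d) :
    DependsOn (IsBad J₁ M L k z)
      ((box z L ×ˢ Finset.range (J₁ * M + 1) : Finset (Site d × ℕ)) : Set (Site d × ℕ)) := by
  intro x y hxy
  have hxy' : ∀ u ∈ box z L, ∀ ρ ≤ J₁ * M, x (u, ρ) = y (u, ρ) := by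
    intro u hu ρ hρ
    exact hxy _ (by simpa [hu] using Nat.lt_succ_of_le hρ)
  have h1 : IsCrowded (J₁ * M) L z x = IsCrowded (J₁ * M) L z y := by
    refine propext (exists_congr fun ρ => and_congr_right fun hρ => ?_)
    rw [Finset.sum_congr rfl]
    rintro ⟨u, σ⟩ hi
    obtain ⟨hu, hσ⟩ := Finset.mem_product.1 hi
    refine hxy' u hu σ ?_
    simp only [Finset.mem_insert, Finset.mem_singleton] at hσ
    omega
  have h2 : ∀ q < J₁, occupied M q x ∩ box z L = occupied M q y ∩ box z L := by
    intro q hq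
    ext u
    refine and_congr_left fun hu => exists_congr fun ρ => and_congr_right fun hρ => ?_
    have hlt : ρ < J₁ * M := by
      rw [← Nat.div_lt_iff_lt_mul hM, hρ]
      exact hq
    rw [hxy' u hu ρ hlt.le]
  have h3 : IsChained J₁ M L k z x = IsChained J₁ M L k z y := by
    refine propext (exists_congr fun q => and_congr_right fun hq => ?_)
    rw [h2 q hq]
  rw [IsBad, IsBad, h1, h3]

section

variable {d : ℕ} {γ₀ : ℝ} {Ω : Type*} [MeasurableSpace Ω] {P : Measure Ω}
  {Φ : Ω → Config d}

theorem measurable_cellCounts (hd : 1 ≤ d) (hΦ : IsPoissonProcess P (booleanIntensity d γ₀) Φ)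
    (J : ℕ) (i : Site d × ℕ) : Measurable fun ω => cellCounts J (Φ ω) i :=
  hΦ.measurable_count (measurableSet_cell hd J i)

theorem iIndepFun_cellCounts (hd : 1 ≤ d) (hΦ : IsPoissonProcess P (booleanIntensity d γ₀) Φ)
    (J : ℕ) : iIndepFun (fun i ω => cellCounts J (Φ ω) i) P :=
  iIndepFun_of_fin fun n g hg => hΦ.indep n (fun i => cell J (g i))
    (fun i => measurableSet_cell hd J (g i))
    (fun _ _ hij => pairwise_disjoint_cell J (hg.ne hij))

variable [IsProbabilityMeasure P]

theorem measure_isCrowded_le (hd : 1 ≤ d) (hΦ : IsPoissonProcess P (booleanIntensity d γ₀) Φ)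
    {J : ℕ} (hJ : 0 < J) (L : ℕ) (z : Site d) :
    P {ω | IsCrowded J L z (cellCounts J (Φ ω))} ≤
      J * (((2 * L + 1) ^ d * 2 : ℕ) * ENNReal.ofReal (γ₀ / J)) ^ 2 := by
  calc _ ≤ P (⋃ ρ ∈ Finset.range J,
        {ω | 2 ≤ (Φ ω).count (⋃ i ∈ box z L ×ˢ {ρ, ρ + 1}, cell J i)}) := by
        refine measure_mono ?_
        rintro ω ⟨ρ, hρ, h⟩
        simp only [mem_iUnion]
        refine ⟨ρ, Finset.mem_range.2 hρ, ?_⟩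
        rw [mem_ofPred_eq, count_biUnion (pairwise_disjoint_cell J)]
        exact h
    _ ≤ ∑ ρ ∈ Finset.range J,
        P {ω | 2 ≤ (Φ ω).count (⋃ i ∈ box z L ×ˢ {ρ, ρ + 1}, cell J i)} :=
        measure_biUnion_finset_le _ _
    _ ≤ ∑ ρ ∈ Finset.range J,
        (((2 * L + 1) ^ d * 2 : ℕ) * ENNReal.ofReal (γ₀ / J)) ^ 2 := by
        refine Finset.sum_le_sum fun ρ _ => ?_
        have hle : booleanIntensity d γ₀ (⋃ i ∈ box z L ×ˢ {ρ, ρ + 1}, cell J i) ≤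
            ((2 * L + 1) ^ d * 2 : ℕ) * ENNReal.ofReal (γ₀ / J) := by
          refine (measure_biUnion_finset_le _ _).trans ?_
          refine (Finset.sum_le_sum fun i _ => booleanIntensity_cell_le hd γ₀ hJ i).trans_eq ?_
          rw [Finset.sum_const, nsmul_eq_mul, Finset.card_product, card_box,
            Finset.card_pair (by omega)]
        refine (hΦ.measure_two_le_count_le
          (Finset.measurableSet_biUnion _ fun i _ => measurableSet_cell hd J i) ?_).trans ?_
        · exact ne_top_of_le_ne_top
            (ENNReal.mul_ne_top (ENNReal.natCast_ne_top _) ENNReal.ofReal_ne_top) hle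
        · gcongr
    _ = _ := by rw [Finset.sum_const, nsmul_eq_mul, Finset.card_range]

theorem measure_mem_occupied_le (hd : 1 ≤ d) (hΦ : IsPoissonProcess P (booleanIntensity d γ₀) Φ)
    {J₁ M : ℕ} (hJ₁ : 0 < J₁) (hM : 0 < M) (q : ℕ) (u : Site d) :
    P {ω | u ∈ occupied M q (cellCounts (J₁ * M) (Φ ω))} ≤ ENNReal.ofReal (γ₀ / J₁) := by
  calc _ ≤ P (⋃ ρ ∈ Finset.Ico (q * M) ((q + 1) * M),
        {ω | (Φ ω).count (cell (J₁ * M) (u, ρ)) ≠ 0}) := by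
        refine measure_mono ?_
        rintro ω ⟨ρ, hρ, h⟩
        simp only [mem_iUnion]
        refine ⟨ρ, ?_, h⟩
        rw [Finset.mem_Ico, ← Nat.le_div_iff_mul_le hM, ← Nat.div_lt_iff_lt_mul hM]
        omega
    _ ≤ ∑ ρ ∈ Finset.Ico (q * M) ((q + 1) * M), ENNReal.ofReal (γ₀ / (J₁ * M : ℕ)) := by
        refine (measure_biUnion_finset_le _ _).trans (Finset.sum_le_sum fun ρ _ => ?_)
        have hle := booleanIntensity_cell_le hd γ₀ (Nat.mul_pos hJ₁ hM) (u, ρ)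
        exact (hΦ.measure_count_ne_zero_le (measurableSet_cell hd _ _)
          (ne_top_of_le_ne_top ENNReal.ofReal_ne_top hle)).trans hle
    _ = ENNReal.ofReal (γ₀ / J₁) := by
        have h : (q + 1) * M - q * M = M := by rw [add_mul, one_mul, Nat.add_sub_cancel_left]
        rw [Finset.sum_const, Nat.card_Ico, h, nsmul_eq_mul, ← ENNReal.ofReal_natCast,
          ← ENNReal.ofReal_mul (by positivity)]
        have hJ₁' : (J₁ : ℝ) ≠ 0 := by exact_mod_cast hJ₁.ne'
        have hM' : (M : ℝ) ≠ 0 := by exact_mod_cast hM.ne'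
        congr 1
        push_cast
        field_simp

theorem dependsOn_mem_occupied {M : ℕ} (hM : 0 < M) (q : ℕ) (u : Site d) :
    DependsOn (fun x => u ∈ occupied M q x)
      (({u} ×ˢ Finset.Ico (q * M) ((q + 1) * M) : Finset (Site d × ℕ)) : Set (Site d × ℕ)) := by
  intro x y hxy
  refine propext (exists_congr fun ρ => and_congr_right fun hρ => ?_)
  rw [hxy (u, ρ)]
  rw [Finset.mem_coe, Finset.mem_product, Finset.mem_Ico, ← Nat.le_div_iff_mul_le hM,
    ← Nat.div_lt_iff_lt_mul hM]
  exact ⟨Finset.mem_singleton_self u, by simp only; omega⟩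

/-- Within one block of levels the occupied sites are a sparse Bernoulli percolation, so that
Peierls' estimate applies. -/
theorem measure_isChained_le (hd : 1 ≤ d) (hΦ : IsPoissonProcess P (booleanIntensity d γ₀) Φ)
    {J₁ M : ℕ} (hJ₁ : 0 < J₁) (hM : 0 < M) (L k : ℕ) (z : Site d) :
    P {ω | IsChained J₁ M L k z (cellCounts (J₁ * M) (Φ ω))} ≤
      J₁ * ((2 * L + 1) ^ d : ℕ) *
        (((7 ^ d : ℕ) * ENNReal.ofReal (γ₀ / J₁)) ^ k * ENNReal.ofReal (γ₀ / J₁)) := by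
  set p := ENNReal.ofReal (γ₀ / J₁)
  have key : ∀ q u, P {ω | u ∈ occupied M q (cellCounts (J₁ * M) (Φ ω)) ∧
      ∃ v, OpenPath 2 (occupied M q (cellCounts (J₁ * M) (Φ ω))) u v ∧
        (k : ℝ) * ((1 : ℕ) + (2 : ℕ)) ≤ dist u v} ≤ ((7 ^ d : ℕ) * p) ^ k * p := by
    intro q u
    refine measure_openPath_le one_pos P (fun ω => occupied M q (cellCounts (J₁ * M) (Φ ω))) p
      (fun l hl => ?_) k u
    refine measure_forall_mem_le_pow (measurable_cellCounts hd hΦ (J₁ * M))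
      (iIndepFun_cellCounts hd hΦ (J₁ * M))
      (fun u => {u} ×ˢ Finset.Ico (q * M) ((q + 1) * M)) (fun u x => u ∈ occupied M q x)
      (dependsOn_mem_occupied hM q) p (measure_mem_occupied_le hd hΦ hJ₁ hM q) l (hl.imp ?_)
    intro v w hvw
    refine Finset.disjoint_product.2 (Or.inl (Finset.disjoint_singleton.2 ?_))
    rintro rfl
    rw [dist_self] at hvw
    norm_num at hvw
  calc _ ≤ P (⋃ q ∈ Finset.range J₁, ⋃ u ∈ box z L,
        {ω | u ∈ occupied M q (cellCounts (J₁ * M) (Φ ω)) ∧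
          ∃ v, OpenPath 2 (occupied M q (cellCounts (J₁ * M) (Φ ω))) u v ∧
            (k : ℝ) * ((1 : ℕ) + (2 : ℕ)) ≤ dist u v}) := by
        refine measure_mono ?_
        rintro ω ⟨q, hq, u, ⟨hu, hub⟩, v, hpath, hv⟩
        simp only [mem_iUnion]
        refine ⟨q, Finset.mem_range.2 hq, u, hub, hu, v, hpath.mono inter_subset_left, ?_⟩
        norm_num
        exact hv
    _ ≤ ∑ q ∈ Finset.range J₁, ∑ u ∈ box z L, ((7 ^ d : ℕ) * p) ^ k * p :=
        (measure_biUnion_finset_le _ _).trans (Finset.sum_le_sum fun q _ =>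
          (measure_biUnion_finset_le _ _).trans (Finset.sum_le_sum fun u _ => key q u))
    _ = _ := by
        rw [Finset.sum_const, Finset.sum_const, Finset.card_range, card_box, nsmul_eq_mul,
          nsmul_eq_mul, mul_assoc]

end

/-! ### Bad sites do not percolate -/

/-- The radius of the box on which the badness of a site depends. -/
def badRange (J₁ k : ℕ) : ℕ := J₁ * (3 * k + 2) + 2

/-- An upper bound for the probability that a site is bad. -/
noncomputable def badBound (d : ℕ) (γ₀ : ℝ) (J₁ M k : ℕ) : ℝ :=
  (J₁ * M : ℕ) * (((2 * badRange J₁ k + 1) ^ d * 2 : ℕ) * (γ₀ / (J₁ * M : ℕ))) ^ 2 +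
    J₁ * ((2 * badRange J₁ k + 1) ^ d : ℕ) * (((7 ^ d : ℕ) * (γ₀ / J₁)) ^ k * (γ₀ / J₁))

theorem badBound_nonneg (d : ℕ) {γ₀ : ℝ} (hγ₀ : 0 < γ₀) (J₁ M k : ℕ) :
    0 ≤ badBound d γ₀ J₁ M k := by
  unfold badBound
  positivity

theorem measure_isBad_le {d : ℕ} (hd : 1 ≤ d) {γ₀ : ℝ} (hγ₀ : 0 < γ₀) {Ω : Type*}
    [MeasurableSpace Ω] {P : Measure Ω} [IsProbabilityMeasure P] {Φ : Ω → Config d}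
    (hΦ : IsPoissonProcess P (booleanIntensity d γ₀) Φ) {J₁ M : ℕ} (hJ₁ : 0 < J₁) (hM : 0 < M)
    (k : ℕ) (z : Site d) :
    P {ω | IsBad J₁ M (badRange J₁ k) k z (cellCounts (J₁ * M) (Φ ω))} ≤
      ENNReal.ofReal (badBound d γ₀ J₁ M k) := by
  have h1 := measure_isCrowded_le hd hΦ (Nat.mul_pos hJ₁ hM) (badRange J₁ k) z
  have h2 := measure_isChained_le hd hΦ hJ₁ hM (badRange J₁ k) k z
  calc _ ≤ P {ω | IsCrowded (J₁ * M) (badRange J₁ k) z (cellCounts (J₁ * M) (Φ ω))} +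
        P {ω | IsChained J₁ M (badRange J₁ k) k z (cellCounts (J₁ * M) (Φ ω))} :=
        measure_union_le _ _
    _ ≤ _ := add_le_add h1 h2
    _ = _ := by
        rw [badBound, ENNReal.ofReal_add (by positivity) (by positivity),
          ENNReal.ofReal_mul (by positivity), ENNReal.ofReal_pow (by positivity),
          ENNReal.ofReal_mul (by positivity), ENNReal.ofReal_natCast, ENNReal.ofReal_natCast,
          ENNReal.ofReal_mul (by positivity), ENNReal.ofReal_mul (by positivity),
          ENNReal.ofReal_natCast, ENNReal.ofReal_natCast,
          ENNReal.ofReal_mul (by positivity), ENNReal.ofReal_pow (by positivity),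
          ENNReal.ofReal_mul (by positivity), ENNReal.ofReal_natCast]

/-- The number of steps available to a walk on separated bad sites. -/
def badSteps (d J₁ k : ℕ) : ℕ := (2 * (2 * badRange J₁ k + 1 + 2) + 1) ^ d

/-- The parameters are chosen in the order `J₁`, `k`, `M`: sparse occupied sites, then a box that
is long enough for the exponential decay to beat its volume, then levels that are fine enough to
separate the radii in this box. -/
theorem exists_badBound_le (d : ℕ) {γ₀ : ℝ} (hγ₀ : 0 < γ₀) :
    ∃ J₁ M k : ℕ, 0 < J₁ ∧ 0 < M ∧ badSteps d J₁ k * badBound d γ₀ J₁ M k ≤ 1 / 2 := by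
  obtain ⟨J₁, hJ₁⟩ := exists_nat_gt (2 * (7 : ℝ) ^ d * γ₀)
  have h7 : (1 : ℝ) ≤ 7 ^ d := one_le_pow₀ (by norm_num)
  have hJpos : (0 : ℝ) < J₁ := lt_trans (by positivity) hJ₁
  have hq : (7 : ℝ) ^ d * (γ₀ / J₁) ≤ 1 / 2 := by
    rw [← mul_div_assoc, div_le_iff₀ hJpos]
    linarith
  have hq1 : γ₀ / J₁ ≤ 1 := by
    rw [div_le_one hJpos]
    nlinarith
  set c : ℝ := 12 * J₁ + 15 with hc
  -- exponential decay beats the polynomial growth of the box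
  have hlim : Filter.Tendsto (fun n : ℕ => (J₁ * (c ^ d * c ^ d)) * 2 *
      ((n : ℝ) ^ (2 * d) * (1 / 2 : ℝ) ^ n)) Filter.atTop (nhds 0) := by
    have := (tendsto_pow_const_mul_const_pow_of_abs_lt_one (2 * d)
      (r := (1 / 2 : ℝ)) (by rw [abs_of_pos] <;> norm_num)).const_mul ((J₁ * (c ^ d * c ^ d)) * 2)
    simpa using this
  obtain ⟨k, hk⟩ := (((Filter.tendsto_add_atTop_iff_nat 1).2 hlim).eventually
    (ge_mem_nhds (show (0 : ℝ) < 1 / 4 by norm_num))).exists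
  set L := badRange J₁ k with hL
  set C := badSteps d J₁ k with hC
  obtain ⟨M, hM⟩ := exists_nat_gt (4 * (C * (((2 * L + 1) ^ d * 2 : ℕ) * γ₀) ^ 2))
  have hMpos : (0 : ℝ) < M := lt_of_le_of_lt (by positivity) hM
  refine ⟨J₁, M, k, by exact_mod_cast hJpos, by exact_mod_cast hMpos, ?_⟩
  have hLc : (2 * (2 * L + 1 + 2) + 1 : ℝ) ≤ c * (k + 1) := by
    rw [hL, hc, badRange]
    push_cast
    have hk0 : (0 : ℝ) ≤ k := k.cast_nonneg
    have hJ1 : (1 : ℝ) ≤ J₁ := by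
      have : 0 < J₁ := by exact_mod_cast hJpos
      exact_mod_cast this
    nlinarith
  have hCc : (C : ℝ) ≤ c ^ d * (k + 1) ^ d := by
    rw [hC, badSteps, ← mul_pow]
    push_cast
    exact pow_le_pow_left₀ (by positivity) hLc d
  have hVc : (((2 * L + 1) ^ d : ℕ) : ℝ) ≤ c ^ d * (k + 1) ^ d := by
    rw [← mul_pow]
    push_cast
    exact pow_le_pow_left₀ (by positivity) (by linarith [L.cast_nonneg (α := ℝ)]) d
  have hc0 : 0 ≤ c := by positivity
  have hchain : (C : ℝ) * (J₁ * ((2 * L + 1) ^ d : ℕ) *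
      (((7 ^ d : ℕ) * (γ₀ / J₁)) ^ k * (γ₀ / J₁))) ≤ 1 / 4 := by
    calc (C : ℝ) * (J₁ * ((2 * L + 1) ^ d : ℕ) * (((7 ^ d : ℕ) * (γ₀ / J₁)) ^ k * (γ₀ / J₁)))
        ≤ (c ^ d * (k + 1) ^ d) * (J₁ * (c ^ d * (k + 1) ^ d) * ((1 / 2) ^ k * 1)) := by
          push_cast at hVc ⊢
          gcongr
      _ = (J₁ * (c ^ d * c ^ d)) * 2 * (((k + 1 : ℕ) : ℝ) ^ (2 * d) * (1 / 2 : ℝ) ^ (k + 1)) := by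
          push_cast
          ring
      _ ≤ 1 / 4 := hk
  have hcrowd : (C : ℝ) * ((J₁ * M : ℕ) *
      (((2 * L + 1) ^ d * 2 : ℕ) * (γ₀ / (J₁ * M : ℕ))) ^ 2) ≤ 1 / 4 := by
    have hJ1 : (1 : ℝ) ≤ J₁ := by
      have : 0 < J₁ := by exact_mod_cast hJpos
      exact_mod_cast this
    generalize hA : (((2 * L + 1) ^ d * 2 : ℕ) : ℝ) = A at *
    have : (C : ℝ) * ((J₁ * M : ℕ) * (A * (γ₀ / (J₁ * M : ℕ))) ^ 2) =
        C * (A * γ₀) ^ 2 / (J₁ * M) := by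
      push_cast
      field_simp
    rw [this, div_le_iff₀ (by positivity)]
    nlinarith
  rw [badBound, mul_add]
  linarith

/-- There is a path of bad sites from the box of radius `R` about the origin to a site at distance
at least `D` from its starting point. -/
def HasBadPath {d : ℕ} (J₁ M k R D : ℕ) (x : Site d × ℕ → ℕ∞) : Prop :=
  ∃ u ∈ box (0 : Site d) R, u ∈ {z | IsBad J₁ M (badRange J₁ k) k z x} ∧
    ∃ v, OpenPath 2 {z | IsBad J₁ M (badRange J₁ k) k z x} u v ∧ (D : ℝ) ≤ dist u v

/-- A long path of bad sites that starts in a given box is improbable. -/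
theorem exists_measure_badPath_le {d : ℕ} (hd : 1 ≤ d) {γ₀ : ℝ} (hγ₀ : 0 < γ₀) {Ω : Type*}
    [MeasurableSpace Ω] {P : Measure Ω} [IsProbabilityMeasure P] {Φ : Ω → Config d}
    (hΦ : IsPoissonProcess P (booleanIntensity d γ₀) Φ) {J₁ M k : ℕ} (hJ₁ : 0 < J₁) (hM : 0 < M)
    (hbound : badSteps d J₁ k * badBound d γ₀ J₁ M k ≤ 1 / 2) (R : ℕ) {ε : ENNReal}
    (hε : 0 < ε) :
    ∃ D : ℕ, P {ω | HasBadPath J₁ M k R D (cellCounts (J₁ * M) (Φ ω))} ≤ ε := by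
  set L := badRange J₁ k
  set p := ENNReal.ofReal (badBound d γ₀ J₁ M k) with hp
  let E : Ω → Set (Site d) := fun ω => {z | IsBad J₁ M L k z (cellCounts (J₁ * M) (Φ ω))}
  have hC1 : (1 : ℝ) ≤ badSteps d J₁ k := by
    rw [badSteps]
    exact_mod_cast Nat.one_le_pow _ _ (by omega)
  have hp1 : p ≤ 1 := by
    rw [hp, ← ENNReal.ofReal_one]
    refine ENNReal.ofReal_le_ofReal ?_
    nlinarith [badBound_nonneg d hγ₀ J₁ M k]
  have hCp : (badSteps d J₁ k : ENNReal) * p ≤ 2⁻¹ := by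
    rw [hp, ← ENNReal.ofReal_natCast, ← ENNReal.ofReal_mul (by positivity)]
    refine (ENNReal.ofReal_le_ofReal hbound).trans_eq ?_
    rw [one_div, ENNReal.ofReal_inv_of_pos (by norm_num), ENNReal.ofReal_ofNat]
  have key : ∀ (n : ℕ) (u : Site d), P {ω | u ∈ E ω ∧ ∃ v, OpenPath 2 (E ω) u v ∧
      (n : ℝ) * ((2 * L + 1 : ℕ) + (2 : ℕ)) ≤ dist u v} ≤ (2⁻¹ : ENNReal) ^ n := by
    intro n u
    refine (measure_openPath_le (Nat.succ_pos _) P E p (fun l hl => ?_) n u).trans ?_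
    · refine measure_forall_mem_le_pow (measurable_cellCounts hd hΦ (J₁ * M))
        (iIndepFun_cellCounts hd hΦ (J₁ * M))
        (fun z => box z L ×ˢ Finset.range (J₁ * M + 1)) (fun z x => IsBad J₁ M L k z x)
        (dependsOn_isBad hM L k) p (measure_isBad_le hd hγ₀ hΦ hJ₁ hM k) l (hl.imp ?_)
      intro v w hvw
      refine Finset.disjoint_product.2 (Or.inl (Finset.disjoint_left.2 fun x hx hx' => ?_))
      rw [mem_box] at hx hx'
      push_cast at hvw
      linarith [dist_triangle_right v w x]
    · calc _ ≤ (2⁻¹ : ENNReal) ^ n * 1 := by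
            refine mul_le_mul' (pow_le_pow_left' ?_ n) hp1
            exact hCp
        _ = _ := mul_one _
  have hlim : Filter.Tendsto (fun n : ℕ => (((2 * R + 1) ^ d : ℕ) : ENNReal) * (2⁻¹ : ENNReal) ^ n)
      Filter.atTop (nhds 0) := by
    have := ENNReal.Tendsto.const_mul (a := (((2 * R + 1) ^ d : ℕ) : ENNReal))
      (ENNReal.tendsto_pow_atTop_nhds_zero_of_lt_one (r := 2⁻¹) (by norm_num))
      (Or.inr (ENNReal.natCast_ne_top _))
    simpa using this
  obtain ⟨n, hn⟩ := (hlim.eventually (ge_mem_nhds hε)).exists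
  refine ⟨n * (2 * L + 1 + 2), le_trans ?_ hn⟩
  calc _ ≤ P (⋃ u ∈ box (0 : Site d) R, {ω | u ∈ E ω ∧ ∃ v, OpenPath 2 (E ω) u v ∧
      (n : ℝ) * ((2 * L + 1 : ℕ) + (2 : ℕ)) ≤ dist u v}) := by
        refine measure_mono ?_
        rintro ω ⟨u, hu, huE, v, hpath, hv⟩
        simp only [mem_iUnion]
        refine ⟨u, hu, huE, v, hpath, ?_⟩
        push_cast at hv ⊢
        exact hv
    _ ≤ ∑ u ∈ box (0 : Site d) R, (2⁻¹ : ENNReal) ^ n :=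
        (measure_biUnion_finset_le _ _).trans (Finset.sum_le_sum fun u _ => key n u)
    _ = _ := by rw [Finset.sum_const, card_box, nsmul_eq_mul]

/-! ### Maximality inside a window -/

/-- The interiors of the grains `K` and `L` meet. -/
def Overlap {d : ℕ} (K L : Grain d) : Prop :=
  ¬ Disjoint (interior (K : Set (Space d))) (interior (L : Set (Space d)))

theorem Overlap.symm {d : ℕ} {K L : Grain d} (h : Overlap K L) : Overlap L K :=
  fun h' => h h'.symm

theorem IsHardCore.eq_of_overlap {d : ℕ} {ψ : Set (Grain d)} (h : IsHardCore ψ) {K L : Grain d}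
    (hK : K ∈ ψ) (hL : L ∈ ψ) (hKL : Overlap K L) : K = L := by
  by_contra hne
  exact hKL (h K hK L hL hne)

theorem IsHardCore.mono {d : ℕ} {ψ ψ' : Set (Grain d)} (h : IsHardCore ψ) (hψ : ψ' ⊆ ψ) :
    IsHardCore ψ' :=
  fun K hK L hL => h K (hψ hK) L (hψ hL)

/-- Local maximality of `ψ` in `φ` with respect to changes inside `U`. -/
def IsMaximalWithin {d : ℕ} (h : Grain d → ℝ) (U φ ψ : Set (Grain d)) : Prop :=
  ψ ⊆ φ ∧ IsHardCore ψ ∧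
    ∀ ψ' : Set (Grain d), ψ' ⊆ φ → IsHardCore ψ' → symmDiff ψ ψ' ⊆ U → ψ' ≠ ψ →
      ∑ᶠ K ∈ ψ' \ ψ, h K < ∑ᶠ K ∈ ψ \ ψ', h K

/-- A locally maximal thinning is, in any window `W`, maximal with respect to changes that do not
interact with the grains outside `W`. -/
theorem IsLocallyMaximal.isMaximalWithin {d : ℕ} {h : Grain d → ℝ} {φ ψ U W : Set (Grain d)}
    (hψ : IsLocallyMaximal h φ ψ) (hfin : (φ ∩ U).Finite)
    (hUW : ∀ K ∈ φ ∩ U, ∀ L ∈ φ, Overlap K L → L ∈ W) :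
    IsMaximalWithin h U (φ ∩ W) (ψ ∩ W) := by
  obtain ⟨hsub, hhc, hmax⟩ := hψ
  refine ⟨inter_subset_inter_left _ hsub, hhc.mono inter_subset_left, ?_⟩
  intro ψ' hψ' hhc' hU hne
  have h1 : (ψ' ∪ ψ \ W) \ ψ = ψ' \ (ψ ∩ W) := by
    ext K
    have := @hψ' K
    simp only [mem_sdiff, mem_union, mem_inter_iff] at this ⊢
    tauto
  have h2 : ψ \ (ψ' ∪ ψ \ W) = (ψ ∩ W) \ ψ' := by
    ext K
    simp only [mem_sdiff, mem_union, mem_inter_iff]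
    tauto
  have h3 : symmDiff ψ (ψ' ∪ ψ \ W) = symmDiff (ψ ∩ W) ψ' := by
    rw [Set.symmDiff_def, Set.symmDiff_def, h1, h2]
  have key : ∀ K ∈ ψ', ∀ L ∈ ψ \ W, K ≠ L → ¬ Overlap K L := by
    intro K hK L hL hne hKL
    by_cases hKψ : K ∈ ψ
    · exact hne (hhc.eq_of_overlap hKψ hL.1 hKL)
    · refine hL.2 (hUW K ⟨(hψ' hK).1, hU ?_⟩ L (hsub hL.1) hKL)
      exact Or.inr ⟨hK, fun h => hKψ h.1⟩
  have := hmax (ψ' ∪ ψ \ W) (union_subset (hψ'.trans inter_subset_left)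
    (sdiff_subset.trans hsub)) ?_ ?_ ?_
  · rwa [h1, h2] at this
  · rintro K (hK | hK) L (hL | hL) hne
    · exact hhc' K hK L hL hne
    · exact not_not.1 (key K hK L hL hne)
    · exact not_not.1 fun h => key L hL K hK hne.symm (Overlap.symm h)
    · exact hhc K hK.1 L hL.1 hne
  · rw [h3]
    refine hfin.subset (subset_inter ?_ hU)
    rintro K (hK | hK)
    · exact hsub hK.1.1
    · exact (hψ' hK.1).1
  · intro heq
    apply hne
    rw [← heq]
    ext K
    have := @hψ' K
    simp only [mem_sdiff, mem_union, mem_inter_iff] at this ⊢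
    tauto

/-- Adding one grain and removing the grains it overlaps is not profitable. -/
theorem IsMaximalWithin.lt_finsum_overlap {d : ℕ} {h : Grain d → ℝ} {U φ ψ : Set (Grain d)}
    (hψ : IsMaximalWithin h U φ ψ) {K : Grain d} (hK : K ∈ φ) (hKψ : K ∉ ψ) (hKU : K ∈ U)
    (hU : ∀ L ∈ ψ, Overlap K L → L ∈ U) :
    h K < ∑ᶠ L ∈ {L ∈ ψ | Overlap K L}, h L := by
  obtain ⟨hsub, hhc, hmax⟩ := hψ
  set N := {L ∈ ψ | Overlap K L} with hN
  have h1 : insert K (ψ \ N) \ ψ = {K} := by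
    ext L
    simp only [mem_sdiff, mem_insert_iff, mem_singleton_iff]
    constructor
    · tauto
    · rintro rfl
      tauto
  have h2 : ψ \ insert K (ψ \ N) = N := by
    ext L
    simp only [mem_sdiff, mem_insert_iff, not_or, not_and, not_not]
    constructor
    · tauto
    · intro hL
      refine ⟨hL.1, ?_, fun _ => hL⟩
      rintro rfl
      exact hKψ hL.1
  have := hmax (insert K (ψ \ N)) (insert_subset hK (sdiff_subset.trans hsub)) ?_ ?_ ?_
  · rw [h1, h2] at this
    simpa using this
  · have hdisj : ∀ L ∈ ψ \ N, ¬ Overlap K L := fun L hL hKL => hL.2 ⟨hL.1, hKL⟩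
    rintro A (rfl | hA) B (rfl | hB) hne
    · exact absurd rfl hne
    · exact not_not.1 (hdisj B hB)
    · exact not_not.1 fun h => hdisj A hA (Overlap.symm h)
    · exact hhc A hA.1 B hB.1 hne
  · rw [Set.symmDiff_def, h1, h2]
    rintro L (hL | rfl)
    · exact hU L hL.1 hL.2
    · exact hKU
  · intro heq
    exact hKψ (heq ▸ mem_insert K _)

/-- Exchanging the two thinnings on a union of clusters of their symmetric difference cannot be
profitable for both of them. -/
theorem IsMaximalWithin.eq_empty_of_closed {d : ℕ} {h : Grain d → ℝ}
    {U φ ψ₁ ψ₂ S : Set (Grain d)} (h₁ : IsMaximalWithin h U φ ψ₁)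
    (h₂ : IsMaximalWithin h U φ ψ₂) (hS : S ⊆ symmDiff ψ₁ ψ₂) (hSU : S ⊆ U)
    (hclosed : ∀ K ∈ S, ∀ L ∈ symmDiff ψ₁ ψ₂, Overlap K L → L ∈ S) : S = ∅ := by
  by_contra hne
  have key : ∀ ψ₁ ψ₂ : Set (Grain d), IsMaximalWithin h U φ ψ₁ → IsMaximalWithin h U φ ψ₂ →
      S ⊆ symmDiff ψ₁ ψ₂ → (∀ K ∈ S, ∀ L ∈ symmDiff ψ₁ ψ₂, Overlap K L → L ∈ S) →
      ∑ᶠ K ∈ S ∩ ψ₂, h K < ∑ᶠ K ∈ S ∩ ψ₁, h K := by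
    rintro ψ₁ ψ₂ ⟨hsub₁, hhc₁, hmax₁⟩ ⟨hsub₂, hhc₂, hmax₂⟩ hS hclosed
    have hmem : ∀ K ∈ S, (K ∈ ψ₁ ∧ K ∉ ψ₂) ∨ (K ∈ ψ₂ ∧ K ∉ ψ₁) := fun K hK => hS hK
    have e1 : symmDiff ψ₁ S \ ψ₁ = S ∩ ψ₂ := by
      ext K
      have := hmem K
      simp only [mem_sdiff, mem_symmDiff, mem_inter_iff]
      tauto
    have e2 : ψ₁ \ symmDiff ψ₁ S = S ∩ ψ₁ := by
      ext K
      simp only [mem_sdiff, mem_symmDiff, mem_inter_iff]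
      tauto
    have hcross : ∀ K ∈ ψ₁ \ S, ∀ L ∈ S \ ψ₁, ¬ Overlap L K := by
      intro K hK L hL hLK
      have hL₂ : L ∈ ψ₂ := by
        have := hmem L hL.1
        have := hL.2
        tauto
      refine hK.2 (hclosed L hL.1 K (Or.inl ⟨hK.1, fun hK₂ => ?_⟩) hLK)
      have := hhc₂.eq_of_overlap hL₂ hK₂ hLK
      exact hL.2 (this ▸ hK.1)
    have := hmax₁ (symmDiff ψ₁ S) ?_ ?_ ?_ ?_
    · rwa [e1, e2] at this
    · rintro K (hK | hK)
      · exact hsub₁ hK.1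
      · rcases hmem K hK.1 with h | h
        · exact hsub₁ h.1
        · exact hsub₂ h.1
    · rintro K (hK | hK) L (hL | hL) hKL
      · exact hhc₁ K hK.1 L hL.1 hKL
      · exact not_not.1 fun h => hcross K hK L hL (Overlap.symm h)
      · exact not_not.1 (hcross L hL K hK)
      · refine hhc₂ K ?_ L ?_ hKL
        · have := hmem K hK.1
          have := hK.2
          tauto
        · have := hmem L hL.1
          have := hL.2
          tauto
    · rw [symmDiff_symmDiff_cancel_left]
      exact hSU
    · intro heq
      exact hne (by simpa using heq)
  have hlt := key ψ₁ ψ₂ h₁ h₂ hS hclosed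
  have hlt' := key ψ₂ ψ₁ h₂ h₁ (symmDiff_comm ψ₁ ψ₂ ▸ hS) (symmDiff_comm ψ₁ ψ₂ ▸ hclosed)
  exact lt_asymm hlt hlt'

/-! ### The configuration near a good site -/

theorem radius_nonneg {d : ℕ} (K : Grain d) : 0 ≤ radius K := by
  unfold radius
  positivity

theorem radius_lt_one {d : ℕ} (hd : 1 ≤ d) {K : Grain d} (hK : K ∈ unitBalls d) :
    radius K < 1 := by
  obtain ⟨x, r, hr, hr1, rfl⟩ := hK
  rwa [radius_ballGrain hd x hr]

theorem level_lt {d : ℕ} (hd : 1 ≤ d) {K : Grain d} (hK : K ∈ unitBalls d) {J : ℕ}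
    (hJ : 0 < J) : level J K < J := by
  rw [level, Nat.floor_lt (mul_nonneg J.cast_nonneg (radius_nonneg K))]
  have : (0 : ℝ) < J := by exact_mod_cast hJ
  nlinarith [radius_lt_one hd hK]

theorem level_mono {d : ℕ} (J : ℕ) {K L : Grain d} (h : radius K ≤ radius L) :
    level J K ≤ level J L :=
  Nat.floor_mono (mul_le_mul_of_nonneg_left h J.cast_nonneg)

theorem isCrowded_of_mem {d : ℕ} (hd : 1 ≤ d) {J L : ℕ} (hJ : 0 < J) {z : Site d} {φ : Config d}
    {K K' : Grain d} (hK : K ∈ φ.grains) (hK' : K' ∈ φ.grains) (hKB : K ∈ unitBalls d)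
    (hKB' : K' ∈ unitBalls d) (hz : site K ∈ box z L) (hz' : site K' ∈ box z L)
    (hne : K ≠ K') (h1 : level J K ≤ level J K') (h2 : level J K' ≤ level J K + 1) :
    IsCrowded J L z (cellCounts J φ) := by
  refine ⟨level J K, level_lt hd hKB hJ, ?_⟩
  have := count_biUnion (pairwise_disjoint_cell J)
    (box z L ×ˢ {level J K, level J K + 1}) φ
  refine le_trans ?_ this.le
  rw [← Set.encard_pair hne, Config.count]
  refine Set.encard_le_encard ?_
  rintro A (rfl | rfl)
  · refine ⟨hK, mem_iUnion₂.2 ⟨(site A, level J A), ?_, hKB, rfl, rfl⟩⟩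
    simp [hz]
  · refine ⟨hK', mem_iUnion₂.2 ⟨(site A, level J A), ?_, hKB', rfl, rfl⟩⟩
    simp only [Finset.mem_product, hz', Finset.mem_insert, Finset.mem_singleton, true_and]
    omega

theorem site_mem_occupied {d : ℕ} (J M : ℕ) {φ : Config d} {K : Grain d}
    (hK : K ∈ φ.grains) (hKB : K ∈ unitBalls d) :
    site K ∈ occupied M (level J K / M) (cellCounts J φ) := by
  refine ⟨level J K, rfl, ?_⟩
  rw [cellCounts, Config.count, Set.encard_ne_zero]
  exact ⟨K, hK, hKB, rfl, rfl⟩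

/-- Where no two radii are close, a grain that belongs to only one of two maximal thinnings
overlaps a larger grain that belongs only to the other one: the smaller grains that it overlaps
are at most `J` in number, and each of them has at most a fraction `1 / J` of its weight. -/
theorem exists_larger_of_not_isCrowded {d : ℕ} (hd : 1 ≤ d) {J L m : ℕ} (hJ : 0 < J) {a : ℝ}
    (ha : (J : ℝ) ^ 2 ≤ a) {φ : Config d} {W ψ₁ ψ₂ : Set (Grain d)}
    (hW : W ⊆ unitBalls d) (h₁ : IsMaximalWithin (expWeight a) (window d m) (φ.grains ∩ W) ψ₁)
    (h₂ : IsMaximalWithin (expWeight a) (window d m) (φ.grains ∩ W) ψ₂) {z : Site d}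
    (hz : dist z 0 + L ≤ m) (hcrowd : ¬ IsCrowded J L z (cellCounts J φ)) {K : Grain d}
    (hK₁ : K ∈ ψ₁) (hK₂ : K ∉ ψ₂) (hKz : dist (site K) z + 2 ≤ L) :
    ∃ K' ∈ ψ₂, K' ∉ ψ₁ ∧ Overlap K K' ∧ radius K < radius K' := by
  by_contra! hcon
  set N := {A ∈ ψ₂ | Overlap K A} with hN
  have hKφ := h₁.1 hK₁
  have hKB := hW hKφ.2
  have hbox : ∀ A ∈ N, site A ∈ box z L := by
    intro A hA
    rw [mem_box, dist_comm]
    have := dist_site_le_two hd hKB (hW (h₂.1 hA.1).2) hA.2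
    linarith [dist_triangle_left (site A) z (site K)]
  have hKbox : site K ∈ box z L := by
    rw [mem_box, dist_comm]
    linarith
  have hwin : ∀ y ∈ box z L, y ∈ box (0 : Site d) m := by
    intro y hy
    rw [mem_box] at hy ⊢
    have := dist_triangle_left (0 : Site d) y z
    linarith
  have hNne : ∀ A ∈ N, A ≠ K := by
    rintro A hA rfl
    exact hK₂ hA.1
  have hle : ∀ A ∈ N, radius A ≤ radius K := by
    intro A hA
    refine hcon A hA.1 (fun hA₁ => hNne A hA ?_) hA.2
    exact (h₁.2.1.eq_of_overlap hK₁ hA₁ hA.2).symm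
  have hlt := h₂.lt_finsum_overlap hKφ hK₂ ⟨hKB, hwin _ hKbox⟩
    (fun A hA hKA => ⟨hW (h₂.1 hA).2, hwin _ (hbox A ⟨hA, hKA⟩)⟩)
  -- distinct grains of `N ∪ {K}` have well separated levels
  have hinj : Set.InjOn (level J) N := by
    intro A hA B hB hAB
    by_contra hne
    exact hcrowd (isCrowded_of_mem hd hJ (h₂.1 hA.1).1 (h₂.1 hB.1).1 (hW (h₂.1 hA.1).2)
      (hW (h₂.1 hB.1).2) (hbox A hA) (hbox B hB) hne hAB.le (by omega))
  have hmaps : Set.MapsTo (level J) N (Finset.range J : Set ℕ) := by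
    intro A hA
    exact Finset.mem_coe.2 (Finset.mem_range.2 (level_lt hd (hW (h₂.1 hA.1).2) hJ))
  have hNfin : N.Finite := Set.Finite.of_injOn hmaps hinj (Finset.finite_toSet _)
  have hcard : hNfin.toFinset.card ≤ J := by
    rw [← Finset.card_range J]
    refine Finset.card_le_card_of_injOn (level J) ?_ ?_
    · simpa using hmaps
    · simpa using hinj
  have hJ' : (0 : ℝ) < J := by exact_mod_cast hJ
  have hweight : ∀ A ∈ N, expWeight a A ≤ expWeight a K / J := by
    intro A hA
    have hlev : level J A + 2 ≤ level J K := by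
      by_contra hlev
      exact hcrowd (isCrowded_of_mem hd hJ (h₂.1 hA.1).1 hKφ.1 (hW (h₂.1 hA.1).2) hKB
        (hbox A hA) hKbox (hNne A hA) (level_mono J (hle A hA)) (by omega))
    have h3 : (J : ℝ) * radius A < level J A + 1 := Nat.lt_floor_add_one _
    have h4 : (level J K : ℝ) ≤ J * radius K :=
      Nat.floor_le (mul_nonneg hJ'.le (radius_nonneg K))
    have h5 : (level J A : ℝ) + 2 ≤ level J K := by exact_mod_cast hlev
    have h6 : J * radius A + 1 ≤ J * radius K := by linarith
    rw [le_div_iff₀ hJ']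
    have hJexp : (J : ℝ) ≤ Real.exp J := by linarith [Real.add_one_le_exp (J : ℝ)]
    calc expWeight a A * J ≤ expWeight a A * Real.exp J := by
          gcongr
          exact (Real.exp_pos _).le
      _ = Real.exp (a * radius A + J) := (Real.exp_add _ _).symm
      _ ≤ Real.exp (a * radius K) := by
          refine Real.exp_le_exp.2 ?_
          -- the radii differ by at least `1 / J`, and `a / J ≥ J`
          have h7 : (J : ℝ) ^ 2 * (radius K - radius A) ≤ a * (radius K - radius A) := by
            refine mul_le_mul_of_nonneg_right ha ?_
            nlinarith
          nlinarith
      _ = expWeight a K := rfl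
  rw [finsum_mem_eq_finite_toFinset_sum _ hNfin] at hlt
  have hsum := Finset.sum_le_card_nsmul hNfin.toFinset (expWeight a) (expWeight a K / J)
    (fun A hA => hweight A (hNfin.mem_toFinset.1 hA))
  rw [nsmul_eq_mul] at hsum
  have hpos : 0 ≤ expWeight a K / J := div_nonneg (Real.exp_pos _).le hJ'.le
  have hfin : (hNfin.toFinset.card : ℝ) * (expWeight a K / J) ≤ J * (expWeight a K / J) :=
    mul_le_mul_of_nonneg_right (by exact_mod_cast hcard) hpos
  rw [mul_div_cancel₀ _ hJ'.ne'] at hfin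
  linarith

/-- Two maximal thinnings agree at a good site. Otherwise a chain of overlapping grains with
increasing radii, taken from the symmetric difference of the two thinnings, starts there. It
passes through each block of levels at most once, and travels less than `3 * k` in each of them,
so that it never leaves the region where it can be continued. -/
theorem site_ne_of_not_isBad {d : ℕ} (hd : 1 ≤ d) {J₁ M k m : ℕ} (hJ₁ : 0 < J₁) (hM : 0 < M)
    {a : ℝ} (ha : ((J₁ * M : ℕ) : ℝ) ^ 2 ≤ a) {φ : Config d} {W ψ₁ ψ₂ : Set (Grain d)}
    (hW : W ⊆ unitBalls d) (hfin : (φ.grains ∩ W).Finite)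
    (h₁ : IsMaximalWithin (expWeight a) (window d m) (φ.grains ∩ W) ψ₁)
    (h₂ : IsMaximalWithin (expWeight a) (window d m) (φ.grains ∩ W) ψ₂) {z : Site d}
    (hz : dist z 0 + badRange J₁ k ≤ m)
    (hgood : ¬ IsBad J₁ M (badRange J₁ k) k z (cellCounts (J₁ * M) φ)) :
    ∀ K ∈ symmDiff ψ₁ ψ₂, site K ≠ z := by
  rintro K₀ hK₀ hsite
  set J := J₁ * M with hJdef
  set L := badRange J₁ k with hL
  have hJ : 0 < J := Nat.mul_pos hJ₁ hM
  have hLreal : (L : ℝ) = J₁ * (3 * k + 2) + 2 := by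
    rw [hL, badRange]
    push_cast
    ring
  rw [IsBad, not_or] at hgood
  obtain ⟨hcrowd, hchain⟩ := hgood
  have hsub : symmDiff ψ₁ ψ₂ ⊆ φ.grains ∩ W := by
    rintro K (hK | hK)
    · exact h₁.1 hK.1
    · exact h₂.1 hK.1
  let O : ℕ → Set (Site d) := fun q => occupied M q (cellCounts J φ) ∩ box z L
  let q : Grain d → ℕ := fun K => level J K / M
  -- the grains that can be reached by such a chain
  let S : Set (Grain d) := {K ∈ symmDiff ψ₁ ψ₂ | ∃ u ∈ O (q K), OpenPath 2 (O (q K)) u (site K) ∧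
    dist z u ≤ q K * (3 * k + 2)}
  have hSfin : S.Finite := hfin.subset fun K hK => hsub hK.1
  have hocc : ∀ K ∈ symmDiff ψ₁ ψ₂, dist z (site K) ≤ L → site K ∈ O (q K) := by
    intro K hK hd
    refine ⟨site_mem_occupied J M (hsub hK).1 (hW (hsub hK).2), ?_⟩
    rw [Finset.mem_coe, mem_box]
    exact hd
  have hK₀S : K₀ ∈ S := by
    refine ⟨hK₀, site K₀, hocc K₀ hK₀ ?_, .refl, ?_⟩
    · rw [hsite, dist_self]
      positivity
    · rw [hsite, dist_self]
      positivity
  obtain ⟨K, hK, hKmax⟩ := Set.exists_max_image S radius hSfin ⟨K₀, hK₀S⟩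
  obtain ⟨hKΔ, u, hu, hpath, hzu⟩ := hK
  have hqJ : q K < J₁ := by
    rw [Nat.div_lt_iff_lt_mul hM]
    exact level_lt hd (hW (hsub hKΔ).2) hJ
  have huK : dist u (site K) < k * 3 := by
    by_contra hfar
    exact hchain ⟨q K, hqJ, u, hu, site K, hpath, not_lt.1 hfar⟩
  have hzK : dist z (site K) + 2 ≤ (q K + 1) * (3 * k + 2) := by
    linarith [dist_triangle z u (site K)]
  have hblocks : ((q K : ℝ) + 1) * (3 * k + 2) ≤ J₁ * (3 * k + 2) := by
    refine mul_le_mul_of_nonneg_right ?_ (by positivity)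
    exact_mod_cast hqJ
  have hnear : dist (site K) z + 2 ≤ L := by
    rw [dist_comm, hLreal]
    linarith
  obtain ⟨K', hK'Δ, hov, hr⟩ : ∃ K' ∈ symmDiff ψ₁ ψ₂, Overlap K K' ∧ radius K < radius K' := by
    rcases hKΔ with hKΔ | hKΔ
    · obtain ⟨K', h, h', hov, hr⟩ := exists_larger_of_not_isCrowded hd hJ ha hW h₁ h₂ hz hcrowd
        hKΔ.1 hKΔ.2 hnear
      exact ⟨K', Or.inr ⟨h, h'⟩, hov, hr⟩
    · obtain ⟨K', h, h', hov, hr⟩ := exists_larger_of_not_isCrowded hd hJ ha hW h₂ h₁ hz hcrowd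
        hKΔ.1 hKΔ.2 hnear
      exact ⟨K', Or.inl ⟨h, h'⟩, hov, hr⟩
  have hstep := dist_site_le_two hd (hW (hsub hKΔ).2) (hW (hsub hK'Δ).2) hov
  have hzK' : dist z (site K') ≤ (q K + 1) * (3 * k + 2) := by
    linarith [dist_triangle z (site K) (site K')]
  have hoccK' : site K' ∈ O (q K') := hocc K' hK'Δ (by rw [hLreal]; linarith)
  have hqq : q K ≤ q K' := Nat.div_le_div_right (level_mono J hr.le)
  refine absurd (hKmax K' ⟨hK'Δ, ?_⟩) (not_le.2 hr)
  rcases hqq.eq_or_lt with heq | hlt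
  · rw [← heq] at hoccK' ⊢
    exact ⟨u, hu, hpath.tail ⟨by exact_mod_cast hstep, hoccK'⟩, hzu⟩
  · refine ⟨site K', hoccK', .refl, hzK'.trans ?_⟩
    refine mul_le_mul_of_nonneg_right ?_ (by positivity)
    exact_mod_cast hlt

/-- Two maximal thinnings agree near the origin unless the bad sites connect a neighbourhood of
the origin to the complement of a large box. -/
theorem inter_window_eq_of_no_badPath {d : ℕ} (hd : 1 ≤ d) {J₁ M k m R D : ℕ} (hJ₁ : 0 < J₁)
    (hM : 0 < M) {a : ℝ} (ha : ((J₁ * M : ℕ) : ℝ) ^ 2 ≤ a) {φ : Config d}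
    {W ψ₁ ψ₂ : Set (Grain d)} (hW : W ⊆ unitBalls d) (hfin : (φ.grains ∩ W).Finite)
    (h₁ : IsMaximalWithin (expWeight a) (window d m) (φ.grains ∩ W) ψ₁)
    (h₂ : IsMaximalWithin (expWeight a) (window d m) (φ.grains ∩ W) ψ₂)
    (hm : R + D + 2 + badRange J₁ k ≤ m)
    (hpath : ¬ HasBadPath J₁ M k R D (cellCounts (J₁ * M) φ)) :
    ψ₁ ∩ window d R = ψ₂ ∩ window d R := by
  set E := {z | IsBad J₁ M (badRange J₁ k) k z (cellCounts (J₁ * M) φ)} with hE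
  have hm' : (R : ℝ) + D + 2 + badRange J₁ k ≤ m := by exact_mod_cast hm
  have hsub : symmDiff ψ₁ ψ₂ ⊆ φ.grains ∩ W := by
    rintro K (hK | hK)
    · exact h₁.1 hK.1
    · exact h₂.1 hK.1
  have hbad : ∀ K ∈ symmDiff ψ₁ ψ₂, dist (site K) 0 ≤ R + D + 2 → site K ∈ E := by
    intro K hK hdist
    by_contra hgood
    exact site_ne_of_not_isBad hd hJ₁ hM ha hW hfin h₁ h₂ (by linarith) hgood K hK rfl
  let S : Set (Grain d) := {K ∈ symmDiff ψ₁ ψ₂ | ∃ u ∈ box (0 : Site d) R, u ∈ E ∧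
    OpenPath 2 E u (site K)}
  have hSdist : ∀ K ∈ S, dist (site K) 0 ≤ R + D := by
    rintro K ⟨hK, u, hu, huE, hp⟩
    have hlt : dist u (site K) < D := by
      by_contra hfar
      exact hpath ⟨u, hu, huE, site K, hp, not_lt.1 hfar⟩
    rw [mem_box] at hu
    rw [dist_comm]
    linarith [dist_triangle 0 u (site K)]
  have hS : S = ∅ := by
    refine h₁.eq_empty_of_closed h₂ (fun K hK => hK.1) ?_ ?_
    · intro K hK
      refine ⟨hW (hsub hK.1).2, ?_⟩
      rw [mem_box, dist_comm]
      have := hSdist K hK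
      have : (0 : ℝ) ≤ badRange J₁ k := by positivity
      linarith
    · intro K hK K' hK' hov
      have hstep := dist_site_le_two hd (hW (hsub hK.1).2) (hW (hsub hK').2) hov
      obtain ⟨u, hu, huE, hp⟩ := hK.2
      refine ⟨hK', u, hu, huE, hp.tail ⟨by exact_mod_cast hstep, hbad K' hK' ?_⟩⟩
      have := hSdist K hK
      linarith [dist_triangle_left (site K') 0 (site K)]
  have hΔ : ∀ K ∈ window d R, K ∉ symmDiff ψ₁ ψ₂ := by
    intro K hKR hK
    have hKS : K ∈ S := by
      refine ⟨hK, site K, hKR.2, hbad K hK ?_, .refl⟩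
      have := mem_box.1 hKR.2
      rw [dist_comm] at this
      have : (0 : ℝ) ≤ D := by positivity
      linarith
    rw [hS] at hKS
    exact hKS
  ext K
  have := hΔ K
  simp only [mem_inter_iff, mem_symmDiff] at this ⊢
  tauto

/-! ### Measurable dependence on finitely many grains -/

/-- The counting measure on the grains of a configuration that lie in `W`, as a kernel. -/
noncomputable def countKernel {d : ℕ} {W : Set (Grain d)} (hW : MeasurableSet W)
    (hfin : ∀ φ : Config d, (φ.grains ∩ W).Finite) : Kernel (Config d) (Grain d) where
  toFun φ := Measure.count.restrict (φ.grains ∩ W)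
  measurable' := by
    refine Measure.measurable_of_measurable_coe _ fun B hB => ?_
    have : (fun φ : Config d => (Measure.count.restrict (φ.grains ∩ W)) B) =
        fun φ => ((Config.count (B ∩ W) φ : ℕ∞) : ENNReal) := by
      funext φ
      rw [Measure.restrict_apply hB, Measure.count_apply (hB.inter (hfin φ).measurableSet),
        Config.count, inter_left_comm]
    rw [this]
    exact (measurable_of_countable (fun n : ℕ∞ => (n : ENNReal))).comp
      (measurable_count (hB.inter hW))

theorem measurableSet_exists_mem {d : ℕ} {Y : Type*} [MeasurableSpace Y] {g : Y → Config d}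
    (hg : Measurable g) {W : Set (Grain d)} (hW : MeasurableSet W)
    (hfin : ∀ φ : Config d, (φ.grains ∩ W).Finite) {T : Set (Y × Grain d)}
    (hT : MeasurableSet T) : MeasurableSet {y | ∃ K ∈ (g y).grains ∩ W, (y, K) ∈ T} := by
  have hmeas := Kernel.measurable_kernel_prodMk_left_of_finite
    (κ := (countKernel hW hfin).comap g hg) hT (fun y => by
      refine ⟨?_⟩
      change Measure.count.restrict ((g y).grains ∩ W) univ < ⊤
      rw [Measure.restrict_apply_univ]
      exact Measure.count_apply_lt_top.2 (hfin (g y)))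
  have : {y | ∃ K ∈ (g y).grains ∩ W, (y, K) ∈ T} =
      {y | (countKernel hW hfin).comap g hg y (Prod.mk y ⁻¹' T) = 0}ᶜ := by
    ext y
    have hy : (countKernel hW hfin).comap g hg y (Prod.mk y ⁻¹' T) =
        Measure.count (Prod.mk y ⁻¹' T ∩ ((g y).grains ∩ W)) :=
      Measure.restrict_apply (measurable_prodMk_left hT)
    rw [mem_compl_iff, mem_ofPred_eq, mem_ofPred_eq, hy, Measure.count_eq_zero_iff,
      ← ne_eq, ← Set.nonempty_iff_ne_empty]
    exact ⟨fun ⟨K, hK, hKT⟩ => ⟨K, hKT, hK⟩, fun ⟨K, hKT, hK⟩ => ⟨K, hK, hKT⟩⟩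
  rw [this]
  exact (hmeas (measurableSet_singleton 0)).compl

theorem measurableSet_exists_tuple {d : ℕ} {W : Set (Grain d)} (hW : MeasurableSet W)
    (hfin : ∀ φ : Config d, (φ.grains ∩ W).Finite) (k : ℕ) {Y : Type*} [MeasurableSpace Y]
    {g : Y → Config d} (hg : Measurable g) {T : Set (Y × (Fin k → Grain d))}
    (hT : MeasurableSet T) :
    MeasurableSet {y | ∃ K : Fin k → Grain d, (∀ i, K i ∈ (g y).grains ∩ W) ∧ (y, K) ∈ T} := by
  induction k generalizing Y with
  | zero =>
    have : {y | ∃ K : Fin 0 → Grain d, (∀ i, K i ∈ (g y).grains ∩ W) ∧ (y, K) ∈ T} =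
        (fun y => (y, Fin.elim0)) ⁻¹' T := by
      ext y
      constructor
      · rintro ⟨K, -, hK⟩
        rwa [mem_preimage, Subsingleton.elim (Fin.elim0) K]
      · intro h
        exact ⟨Fin.elim0, fun i => i.elim0, h⟩
    rw [this]
    exact measurable_prodMk_right hT
  | succ k ih =>
    let T' : Set (Y × (Fin k → Grain d)) :=
      {p | ∃ L ∈ (g p.1).grains ∩ W, (p, L) ∈
        (fun r : (Y × (Fin k → Grain d)) × Grain d =>
          (r.1.1, (Fin.snoc r.1.2 r.2 : Fin (k + 1) → Grain d))) ⁻¹' T}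
    have hsnoc : Measurable fun r : (Y × (Fin k → Grain d)) × Grain d =>
        (r.1.1, (Fin.snoc r.1.2 r.2 : Fin (k + 1) → Grain d)) := by
      refine Measurable.prodMk (by fun_prop) (measurable_pi_lambda _ fun i => ?_)
      refine Fin.lastCases ?_ (fun j => ?_) i
      · simp only [Fin.snoc_last]
        fun_prop
      · simp only [Fin.snoc_castSucc]
        fun_prop
    have hT' : MeasurableSet T' :=
      measurableSet_exists_mem (hg.comp measurable_fst) hW hfin (hsnoc hT)
    convert ih hg hT' using 1
    ext y
    constructor
    · rintro ⟨K, hK, hKT⟩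
      refine ⟨Fin.init K, fun i => hK i.castSucc, K (Fin.last k), hK _, ?_⟩
      simpa using hKT
    · rintro ⟨K, hK, L, hL, hKT⟩
      refine ⟨Fin.snoc K L, fun i => ?_, hKT⟩
      refine Fin.lastCases ?_ (fun j => ?_) i
      · simpa using hL
      · simpa using hK j

/-- The finite configuration with grains `K i`, `i ∈ I`. -/
def tupleConfig {d k : ℕ} (K : Fin k → Grain d) (I : Finset (Fin k)) : Config d :=
  ⟨K '' I, fun _ _ => (I.finite_toSet.image K).subset (sep_subset _ _)⟩

theorem measurable_of_measurable_count {d : ℕ} {Y : Type*} [MeasurableSpace Y] {g : Y → Config d}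
    (h : ∀ B : Set (Grain d), MeasurableSet B → Measurable fun y => (g y).count B) :
    Measurable g := by
  rw [measurable_iff_comap_le]
  change MeasurableSpace.comap g (⨆ B : {B : Set (Grain d) // MeasurableSet B},
    MeasurableSpace.comap (Config.count B.1) inferInstance) ≤ _
  rw [MeasurableSpace.comap_iSup]
  refine iSup_le fun B => ?_
  rw [MeasurableSpace.comap_comp]
  exact (h B.1 B.2).comap_le

theorem measurableSet_injective {d k : ℕ} :
    MeasurableSet {K : Fin k → Grain d | Function.Injective K} := by
  have : {K : Fin k → Grain d | Function.Injective K} =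
      ⋂ (i : Fin k) (j : Fin k) (_ : i ≠ j), {K | K i = K j}ᶜ := by
    ext K
    simp only [mem_ofPred_eq, mem_iInter, mem_compl_iff]
    exact ⟨fun h i j hij heq => hij (h heq), fun h i j heq => by_contra fun hij => h i j hij heq⟩
  rw [this]
  exact MeasurableSet.iInter fun i => MeasurableSet.iInter fun j => MeasurableSet.iInter fun _ =>
    (measurableSet_eq_fun (measurable_pi_apply i) (measurable_pi_apply j)).compl

theorem measurableSet_tupleConfig_mem {d k : ℕ} (I : Finset (Fin k)) {A : Set (Config d)}
    (hA : MeasurableSet A) :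
    MeasurableSet {K : Fin k → Grain d | Function.Injective K ∧ tupleConfig K I ∈ A} := by
  classical
  have hmeas : Measurable fun K : {K : Fin k → Grain d // Function.Injective K} =>
      tupleConfig K.1 I := by
    refine measurable_of_measurable_count fun B hB => ?_
    have : (fun K : {K : Fin k → Grain d // Function.Injective K} =>
        (tupleConfig K.1 I).count B) = fun K => ∑ i ∈ I, if K.1 i ∈ B then 1 else 0 := by
      funext K
      have himage : K.1 '' I ∩ B = K.1 '' (I.filter fun i => K.1 i ∈ B : Finset (Fin k)) := by
        ext A
        simp only [mem_inter_iff, mem_image, Finset.coe_filter, Finset.mem_coe, mem_ofPred_eq]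
        constructor
        · rintro ⟨⟨i, hi, rfl⟩, hB⟩
          exact ⟨i, ⟨hi, hB⟩, rfl⟩
        · rintro ⟨i, ⟨hi, hB⟩, rfl⟩
          exact ⟨⟨i, hi, rfl⟩, hB⟩
      change (K.1 '' I ∩ B).encard = _
      rw [himage, K.2.encard_image, encard_coe_eq_coe_finsetCard, Finset.card_filter]
      push_cast
      rfl
    rw [this]
    refine Finset.measurable_sum _ fun i _ => ?_
    refine Measurable.ite ?_ measurable_const measurable_const
    exact ((measurable_pi_apply i).comp measurable_subtype_coe) hB
  have := measurableSet_injective.subtype_image (hmeas hA)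
  convert this using 1
  ext K
  simp [and_comm]

theorem measurableSet_overlap (d : ℕ) :
    MeasurableSet {p : Grain d × Grain d | Overlap p.1 p.2} := by
  have hclosed : ∀ B : Set (Space d), IsClosed {K : Grain d | B ⊆ (K : Set (Space d))} := by
    intro B
    have : {K : Grain d | B ⊆ (K : Set (Space d))} =
        ⋂ x ∈ B, {K : Grain d | Metric.infDist x (K : Set (Space d)) = 0} := by
      ext K
      simp only [mem_ofPred_eq, mem_iInter]
      refine forall₂_congr fun x _ => ?_
      exact K.isCompact.isClosed.mem_iff_infDist_zero K.nonempty
    rw [this]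
    exact isClosed_biInter fun x _ =>
      isClosed_eq (Metric.lipschitz_infDist_set x).continuous continuous_const
  obtain ⟨Q, hQc, hQd⟩ := exists_countable_dense (Space d)
  have : {p : Grain d × Grain d | Overlap p.1 p.2} = ⋃ q ∈ Q, ⋃ n : ℕ,
      {K : Grain d | Metric.closedBall q (1 / (n + 1)) ⊆ (K : Set (Space d))} ×ˢ
      {K : Grain d | Metric.closedBall q (1 / (n + 1)) ⊆ (K : Set (Space d))} := by
    ext ⟨K, L⟩
    simp only [mem_ofPred_eq, mem_iUnion, mem_prod, Overlap, Set.not_disjoint_iff]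
    constructor
    · rintro ⟨z, hzK, hzL⟩
      obtain ⟨ε, hε, hball⟩ := Metric.isOpen_iff.1 (isOpen_interior.inter isOpen_interior) z
        ⟨hzK, hzL⟩
      obtain ⟨n, hn⟩ := exists_nat_one_div_lt (half_pos hε)
      obtain ⟨q, hq, hqz⟩ := hQd.exists_dist_lt z (show (0 : ℝ) < 1 / (n + 1) by positivity)
      have hsub : Metric.closedBall q (1 / (n + 1)) ⊆ Metric.ball z ε := by
        intro x hx
        rw [Metric.mem_closedBall] at hx
        rw [Metric.mem_ball]
        linarith [dist_triangle x q z, dist_comm q z]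
      exact ⟨q, hq, n, fun x hx => interior_subset (hball (hsub hx)).1,
        fun x hx => interior_subset (hball (hsub hx)).2⟩
    · rintro ⟨q, -, n, hK, hL⟩
      have hq : q ∈ Metric.ball q (1 / ((n : ℝ) + 1)) := Metric.mem_ball_self (by positivity)
      exact ⟨q, interior_maximal (Metric.ball_subset_closedBall.trans hK) Metric.isOpen_ball hq,
        interior_maximal (Metric.ball_subset_closedBall.trans hL) Metric.isOpen_ball hq⟩
  rw [this]
  exact MeasurableSet.biUnion hQc fun q _ => MeasurableSet.iUnion fun n =>
    (hclosed _).measurableSet.prod (hclosed _).measurableSet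

theorem lipschitzWith_diam (d : ℕ) :
    LipschitzWith 2 fun K : Grain d => Metric.diam (K : Set (Space d)) := by
  refine LipschitzWith.of_le_add_mul _ fun K L => ?_
  have hfin : Metric.hausdorffEDist (K : Set (Space d)) L ≠ ⊤ :=
    Metric.hausdorffEDist_ne_top_of_nonempty_of_bounded K.nonempty L.nonempty
      K.isCompact.isBounded L.isCompact.isBounded
  have key : ∀ x ∈ (K : Set (Space d)), ∃ y ∈ (L : Set (Space d)), dist x y ≤ dist K L := by
    intro x hx
    obtain ⟨y, hy, hxy⟩ := L.isCompact.exists_infDist_eq_dist L.nonempty x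
    refine ⟨y, hy, ?_⟩
    rw [← hxy, Metric.NonemptyCompacts.dist_eq]
    exact Metric.infDist_le_hausdorffDist_of_mem hx hfin
  refine Metric.diam_le_of_forall_dist_le (by positivity) fun x hx y hy => ?_
  obtain ⟨x', hx', hxx'⟩ := key x hx
  obtain ⟨y', hy', hyy'⟩ := key y hy
  have h1 := Metric.dist_le_diam_of_mem L.isCompact.isBounded hx' hy'
  have h2 := dist_triangle4 x x' y' y
  rw [dist_comm y' y] at h2
  push_cast
  linarith

theorem measurable_expWeight (d : ℕ) (a : ℝ) : Measurable (expWeight a : Grain d → ℝ) := by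
  have : Continuous (expWeight a : Grain d → ℝ) :=
    Real.continuous_exp.comp
      (continuous_const.mul ((lipschitzWith_diam d).continuous.div_const 2))
  exact this.measurable

/-- Maximality of a subfamily of a finite family of grains, in terms of the index set. -/
theorem isMaximalWithin_image_iff {d k : ℕ} {h : Grain d → ℝ} {U : Set (Grain d)}
    {K : Fin k → Grain d} (hK : Function.Injective K) (I : Finset (Fin k)) :
    IsMaximalWithin h U (range K) (K '' I) ↔
      (∀ i ∈ I, ∀ j ∈ I, i ≠ j → ¬ Overlap (K i) (K j)) ∧
      ∀ I' : Finset (Fin k), (∀ i ∈ I', ∀ j ∈ I', i ≠ j → ¬ Overlap (K i) (K j)) →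
        (∀ i ∈ symmDiff I I', K i ∈ U) → I' ≠ I →
          ∑ i ∈ I' \ I, h (K i) < ∑ i ∈ I \ I', h (K i) := by
  classical
  have hhc : ∀ I : Finset (Fin k), IsHardCore (K '' I) ↔
      ∀ i ∈ I, ∀ j ∈ I, i ≠ j → ¬ Overlap (K i) (K j) := by
    intro I
    constructor
    · intro h i hi j hj hij
      exact not_not.2 (h _ (mem_image_of_mem K hi) _ (mem_image_of_mem K hj) (hK.ne hij))
    · rintro h _ ⟨i, hi, rfl⟩ _ ⟨j, hj, rfl⟩ hij
      exact not_not.1 (h i hi j hj (fun h => hij (h ▸ rfl)))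
  have hsum : ∀ I I' : Finset (Fin k),
      ∑ᶠ A ∈ K '' (I : Set (Fin k)) \ K '' (I' : Set (Fin k)), h A = ∑ i ∈ I \ I', h (K i) := by
    intro I I'
    rw [← image_sdiff hK, finsum_mem_image hK.injOn, ← Finset.coe_sdiff, finsum_mem_coe_finset]
  have hsymm : ∀ I' : Finset (Fin k), symmDiff (K '' I) (K '' I') ⊆ U ↔
      ∀ i ∈ symmDiff I I', K i ∈ U := by
    intro I'
    rw [← image_symmDiff hK, ← Finset.coe_symmDiff, image_subset_iff]
    rfl
  constructor
  · rintro ⟨-, h1, h2⟩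
    refine ⟨(hhc I).1 h1, fun I' hI' hU hne => ?_⟩
    have := h2 (K '' I') (image_subset_range _ _) ((hhc I').2 hI') ((hsymm I').2 hU)
      (fun h => hne (Finset.coe_injective (hK.image_injective h)))
    rwa [hsum, hsum] at this
  · rintro ⟨h1, h2⟩
    refine ⟨image_subset_range _ _, (hhc I).2 h1, fun ψ' hψ' hc hU hne => ?_⟩
    obtain ⟨I', rfl⟩ : ∃ I' : Finset (Fin k), K '' I' = ψ' :=
      ⟨(K ⁻¹' ψ').toFinite.toFinset, by
        rw [Set.Finite.coe_toFinset]
        exact image_preimage_eq_of_subset hψ'⟩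
    rw [hsum, hsum]
    exact h2 I' ((hhc I').1 hc) ((hsymm I').1 hU) (fun h => hne (h ▸ rfl))

theorem measurableSet_isMaximalWithin_image {d k : ℕ} {h : Grain d → ℝ} (hh : Measurable h)
    {U : Set (Grain d)} (hU : MeasurableSet U) (I : Finset (Fin k)) :
    MeasurableSet {K : Fin k → Grain d |
      (∀ i ∈ I, ∀ j ∈ I, i ≠ j → ¬ Overlap (K i) (K j)) ∧
      ∀ I' : Finset (Fin k), (∀ i ∈ I', ∀ j ∈ I', i ≠ j → ¬ Overlap (K i) (K j)) →
        (∀ i ∈ symmDiff I I', K i ∈ U) → I' ≠ I →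
          ∑ i ∈ I' \ I, h (K i) < ∑ i ∈ I \ I', h (K i)} := by
  have hov₂ : Measurable fun p : Grain d × Grain d => Overlap p.1 p.2 :=
    measurableSet_setOfPred.1 (measurableSet_overlap d)
  have hpair : ∀ i j, Measurable fun K : Fin k → Grain d => (K i, K j) := fun i j =>
    (measurable_pi_apply i).prodMk (measurable_pi_apply j)
  have hov : ∀ i j, Measurable fun K : Fin k → Grain d => Overlap (K i) (K j) := fun i j =>
    hov₂.comp (hpair i j)
  have hhc : ∀ I : Finset (Fin k), Measurable fun K : Fin k → Grain d =>
      ∀ i ∈ I, ∀ j ∈ I, i ≠ j → ¬ Overlap (K i) (K j) := fun I =>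
    Measurable.forall fun i => Measurable.forall fun _ => Measurable.forall fun j =>
      Measurable.forall fun _ => Measurable.forall fun _ => (hov i j).not
  refine measurableSet_setOfPred.2 ((hhc I).and (Measurable.forall fun I' => (hhc I').imp
    (Measurable.imp ?_ (Measurable.forall fun _ => ?_))))
  · have hmem : ∀ i, Measurable fun K : Fin k → Grain d => K i ∈ U := fun i =>
      (measurableSet_setOfPred.1 hU).comp (measurable_pi_apply i)
    exact Measurable.forall fun i => Measurable.forall fun _ => hmem i
  · refine measurableSet_setOfPred.1 (measurableSet_lt ?_ ?_) <;>
      exact Finset.measurable_sum _ fun i _ => hh.comp (measurable_pi_apply i)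

/-- The existence of a maximal subconfiguration with a measurable property is a measurable event:
it can be expressed by an enumeration of the finitely many grains in `W`. -/
theorem measurableSet_exists_isMaximalWithin {d : ℕ} {h : Grain d → ℝ} (hh : Measurable h)
    {U W : Set (Grain d)} (hU : MeasurableSet U) (hW : MeasurableSet W)
    (hfin : ∀ φ : Config d, (φ.grains ∩ W).Finite) {A : Set (Config d)} (hA : MeasurableSet A) :
    MeasurableSet {φ : Config d | ∃ ψ ∈ A, IsMaximalWithin h U (φ.grains ∩ W) ψ.grains} := by
  let Q : ∀ k : ℕ, Set (Fin k → Grain d) := fun k => {K | Function.Injective K ∧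
    ∃ I : Finset (Fin k), tupleConfig K I ∈ A ∧ IsMaximalWithin h U (range K) (K '' I)}
  have hQ : ∀ k, MeasurableSet (Q k) := by
    intro k
    have : Q k = ⋃ I : Finset (Fin k), {K : Fin k → Grain d |
        Function.Injective K ∧ tupleConfig K I ∈ A} ∩ {K : Fin k → Grain d |
      (∀ i ∈ I, ∀ j ∈ I, i ≠ j → ¬ Overlap (K i) (K j)) ∧
      ∀ I' : Finset (Fin k), (∀ i ∈ I', ∀ j ∈ I', i ≠ j → ¬ Overlap (K i) (K j)) →
        (∀ i ∈ symmDiff I I', K i ∈ U) → I' ≠ I →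
          ∑ i ∈ I' \ I, h (K i) < ∑ i ∈ I \ I', h (K i)} := by
      ext K
      simp only [mem_iUnion]
      constructor
      · rintro ⟨hK, I, hIA, hI⟩
        exact ⟨I, ⟨hK, hIA⟩, (isMaximalWithin_image_iff hK I).1 hI⟩
      · rintro ⟨I, ⟨hK, hIA⟩, hI⟩
        exact ⟨hK, I, hIA, (isMaximalWithin_image_iff hK I).2 hI⟩
    rw [this]
    exact MeasurableSet.iUnion fun I => (measurableSet_tupleConfig_mem I hA).inter
      (measurableSet_isMaximalWithin_image hh hU I)
  have : {φ : Config d | ∃ ψ ∈ A, IsMaximalWithin h U (φ.grains ∩ W) ψ.grains} =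
      ⋃ k : ℕ, {φ | Config.count W φ = (k : ℕ∞)} ∩
        {φ | ∃ K : Fin k → Grain d, (∀ i, K i ∈ φ.grains ∩ W) ∧ (φ, K) ∈ Prod.snd ⁻¹' Q k} := by
    ext φ
    simp only [mem_ofPred_eq, mem_iUnion, mem_inter_iff, mem_preimage]
    constructor
    · rintro ⟨ψ, hψA, hψ⟩
      let K : Fin (hfin φ).toFinset.card → Grain d := fun i => ((hfin φ).toFinset.equivFin.symm i)
      have hKinj : Function.Injective K :=
        Subtype.val_injective.comp (hfin φ).toFinset.equivFin.symm.injective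
      have hrange : range K = φ.grains ∩ W := by
        have : K = Subtype.val ∘ (hfin φ).toFinset.equivFin.symm := rfl
        rw [this, (hfin φ).toFinset.equivFin.symm.surjective.range_comp, Subtype.range_coe]
        simp
      refine ⟨(hfin φ).toFinset.card, (hfin φ).encard_eq_coe_toFinset_card, K,
        fun i => hrange.subset (mem_range_self i), hKinj, (K ⁻¹' ψ.grains).toFinite.toFinset, ?_⟩
      have himage : K '' ((K ⁻¹' ψ.grains).toFinite.toFinset : Set _) = ψ.grains := by
        rw [Set.Finite.coe_toFinset]
        exact image_preimage_eq_of_subset (hψ.1.trans hrange.superset)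
      have hconf : tupleConfig K (K ⁻¹' ψ.grains).toFinite.toFinset = ψ := Subtype.ext himage
      rw [hconf, himage, hrange]
      exact ⟨hψA, hψ⟩
    · rintro ⟨k, hk, K, hKφ, hKinj, I, hIA, hI⟩
      have hrange : range K = φ.grains ∩ W := by
        refine (finite_range K).eq_of_subset_of_encard_le (range_subset_iff.2 hKφ) ?_
        have hcard : (range K).encard = k := by
          rw [← image_univ, hKinj.encard_image, encard_univ]
          simp
        rw [hcard, ← hk]
        rfl
      exact ⟨tupleConfig K I, hIA, hrange ▸ hI⟩
  rw [this]
  refine MeasurableSet.iUnion fun k => MeasurableSet.inter ?_ ?_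
  · exact measurable_count hW (measurableSet_singleton _)
  · exact measurableSet_exists_tuple hW hfin k measurable_id (measurable_snd (hQ k))

/-! ### Local approximation and equality in distribution -/

/-- The grains of `φ` that belong to `B`, as a configuration. -/
def Config.restrict {d : ℕ} (B : Set (Grain d)) (φ : Config d) : Config d :=
  ⟨φ.grains ∩ B, fun C hC => (φ.2 C hC).subset fun _ hK => ⟨hK.1.1, hK.2⟩⟩

theorem count_restrict {d : ℕ} (B C : Set (Grain d)) (φ : Config d) :
    (φ.restrict B).count C = φ.count (B ∩ C) :=
  congrArg Set.encard (inter_assoc _ _ _)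

theorem measurable_restrict {d : ℕ} {B : Set (Grain d)} (hB : MeasurableSet B) :
    Measurable (Config.restrict B : Config d → Config d) :=
  measurable_of_measurable_count fun C hC => by
    simp only [count_restrict]
    exact measurable_count (hB.inter hC)

theorem window_mono (d : ℕ) : Monotone (window d) := by
  intro m n hmn K hK
  refine ⟨hK.1, ?_⟩
  have := hK.2
  rw [mem_box] at this ⊢
  exact this.trans (by exact_mod_cast hmn)

theorem exists_subset_window {d : ℕ} {t : Set (Grain d)} (ht : t.Finite)
    (hB : t ⊆ unitBalls d) : ∃ R, t ⊆ window d R := by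
  obtain ⟨R, hR⟩ := (ht.image fun K => ⌈dist 0 (site K)⌉₊).bddAbove
  refine ⟨R, fun K hK => ⟨hB hK, mem_box.2 ?_⟩⟩
  have h1 : ⌈dist 0 (site K)⌉₊ ≤ R := hR (mem_image_of_mem _ hK)
  exact (Nat.le_ceil _).trans (by exact_mod_cast h1)

theorem measurable_iSup_enat {Y : Type*} [MeasurableSpace Y] {f : ℕ → Y → ℕ∞}
    (hf : ∀ n, Measurable (f n)) : Measurable fun y => ⨆ n, f n y := by
  -- the order topology of the countable space `ℕ∞` generates its discrete σ-algebra
  have h : @MeasurableSingletonClass ℕ∞ (borel ℕ∞) :=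
    @MeasurableSingletonClass.mk ℕ∞ (borel ℕ∞) fun x => @MeasurableSet.of_compl _ _ (borel ℕ∞)
      (MeasurableSpace.measurableSet_generateFrom (isOpen_compl_singleton (x := x)))
  have : BorelSpace ℕ∞ :=
    ⟨le_antisymm (fun s _ => @Set.Countable.measurableSet ℕ∞ (borel ℕ∞) h s s.to_countable) le_top⟩
  exact Measurable.iSup hf

theorem count_unitBalls_inter {d : ℕ} (B : Set (Grain d)) (φ : Config d) :
    φ.count (unitBalls d ∩ B) = ⨆ R, φ.count (window d R ∩ B) := by
  refine le_antisymm ?_ (iSup_le fun R => Set.encard_le_encard ?_)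
  · refine ENat.forall_natCast_le_iff_le.1 fun n hn => ?_
    obtain ⟨t, ht, htn⟩ := Set.exists_subset_encard_eq hn
    have htf : t.Finite := Set.finite_of_encard_eq_coe htn
    obtain ⟨R, hR⟩ := exists_subset_window htf fun K hK => (ht hK).2.1
    refine le_iSup_of_le R ?_
    rw [← htn]
    exact Set.encard_le_encard fun K hK => ⟨(ht hK).1, hR hK, (ht hK).2.2⟩
  · exact inter_subset_inter_right _ (inter_subset_inter_left _ fun K hK => hK.1)

/-- The law of a configuration of unit balls is determined by the laws of its restrictions to the
windows. -/
theorem measure_eq_of_restrict_window {d : ℕ} (hd : 1 ≤ d) {ν₁ ν₂ : Measure (Config d)}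
    [IsProbabilityMeasure ν₁] [IsProbabilityMeasure ν₂]
    (h₁ : ∀ᵐ ψ ∂ν₁, ψ.restrict (unitBalls d) = ψ) (h₂ : ∀ᵐ ψ ∂ν₂, ψ.restrict (unitBalls d) = ψ)
    (h : ∀ (R : ℕ) (A : Set (Config d)), MeasurableSet A →
      ν₁ (Config.restrict (window d R) ⁻¹' A) = ν₂ (Config.restrict (window d R) ⁻¹' A)) :
    ν₁ = ν₂ := by
  let m : ℕ → MeasurableSpace (Config d) := fun R =>
    MeasurableSpace.comap (Config.restrict (window d R)) inferInstance
  have hm : ∀ R, m R ≤ configMeasurableSpace d := fun R =>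
    (measurable_restrict (measurableSet_window hd R)).comap_le
  have hmono : Monotone m := by
    intro R R' hRR' s hs
    obtain ⟨A, hA, rfl⟩ := hs
    refine ⟨Config.restrict (window d R) ⁻¹' A,
      measurable_restrict (measurableSet_window hd R) hA, ?_⟩
    ext φ
    have : (φ.restrict (window d R')).restrict (window d R) = φ.restrict (window d R) :=
      Subtype.ext (by
        change φ.grains ∩ window d R' ∩ window d R = φ.grains ∩ window d R
        rw [inter_assoc, inter_eq_self_of_subset_right (window_mono d hRR')])
    rw [mem_preimage, mem_preimage, this, mem_preimage]
  have hpi : IsPiSystem (⋃ R, {s | MeasurableSet[m R] s}) :=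
    isPiSystem_iUnion_of_monotone _ (fun R => @MeasurableSpace.isPiSystem_measurableSet _ (m R))
      fun R R' hRR' => hmono hRR'
  have hrestr : @Measurable _ _ (⨆ R, m R) _ (Config.restrict (unitBalls d)) := by
    refine @measurable_of_measurable_count d _ (⨆ R, m R) _ fun B hB => ?_
    simp only [count_restrict, count_unitBalls_inter]
    refine @measurable_iSup_enat (Config d) (⨆ R, m R) _ fun R => ?_
    have h1 : @Measurable _ _ (m R) _ (Config.restrict (window d R)) := comap_measurable _
    have h2 := (measurable_count hB).comp h1
    have h3 : Config.count B ∘ Config.restrict (window d R) =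
        fun φ => φ.count (window d R ∩ B) := funext fun φ => count_restrict _ _ _
    rw [h3] at h2
    exact h2.mono (le_iSup m R) le_rfl
  have key : ∀ s, MeasurableSet[⨆ R, m R] s → ν₁ s = ν₂ s := by
    intro s hs
    refine ext_on_measurableSpace_of_generate_finite _ (⋃ R, {s | MeasurableSet[m R] s}) ?_
      (iSup_le hm) (MeasurableSpace.generateFrom_iUnion_measurableSet m).symm hpi (by simp) hs
    intro t ht
    obtain ⟨R, A, hA, rfl⟩ := mem_iUnion.1 ht
    exact h R A hA
  ext A hA
  have hA₁ : ν₁ A = ν₁ (Config.restrict (unitBalls d) ⁻¹' A) :=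
    measure_congr (h₁.mono fun ψ hψ => by
      change (ψ ∈ A) = (ψ.restrict (unitBalls d) ∈ A)
      rw [hψ])
  have hA₂ : ν₂ A = ν₂ (Config.restrict (unitBalls d) ⁻¹' A) :=
    measure_congr (h₂.mono fun ψ hψ => by
      change (ψ ∈ A) = (ψ.restrict (unitBalls d) ∈ A)
      rw [hψ])
  rw [hA₁, hA₂]
  exact key _ (hrestr hA)

theorem ae_subset_unitBalls {d : ℕ} (hd : 1 ≤ d) {γ₀ : ℝ} {Ω₀ : Type*} [MeasurableSpace Ω₀]
    {P₀ : Measure Ω₀} [IsProbabilityMeasure P₀] {Φ : Ω₀ → Config d}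
    (hΦ : IsPoissonProcess P₀ (booleanIntensity d γ₀) Φ) :
    ∀ᵐ ω ∂P₀, (Φ ω).grains ⊆ unitBalls d := by
  have h0 := booleanIntensity_compl_unitBalls hd γ₀
  have hle := hΦ.measure_count_ne_zero_le (measurableSet_unitBalls hd).compl (by rw [h0]; simp)
  rw [h0, nonpos_iff_eq_zero] at hle
  refine ae_iff.2 (measure_mono_null (fun ω hω => ?_) hle)
  rw [mem_ofPred_eq] at hω ⊢
  rw [Config.count, Set.encard_ne_zero]
  exact not_disjoint_iff_nonempty_inter.1 fun h => hω (disjoint_compl_right_iff_subset.1 h)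

/-- The configurations `φ` that have, in a window of radius `m + 2`, a subconfiguration which is
maximal with respect to changes in the window of radius `m`, and which belongs to `A` when it is
restricted to the window of radius `R`. -/
def approxEvent {d : ℕ} (a : ℝ) (m R : ℕ) (A : Set (Config d)) : Set (Config d) :=
  {φ | ∃ ψ ∈ Config.restrict (window d R) ⁻¹' A,
    IsMaximalWithin (expWeight a) (window d m) (φ.grains ∩ window d (m + 2)) ψ.grains}

theorem measurableSet_approxEvent {d : ℕ} (hd : 1 ≤ d) (a : ℝ) (m R : ℕ) {A : Set (Config d)}
    (hA : MeasurableSet A) : MeasurableSet (approxEvent a m R A) :=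
  measurableSet_exists_isMaximalWithin (measurable_expWeight d a) (measurableSet_window hd m)
    (measurableSet_window hd (m + 2)) (fun φ => finite_inter_window hd φ.2 _)
    (measurable_restrict (measurableSet_window hd R) hA)

/-- A local event for a locally maximal particle process is approximated by an event for the
Poisson process, which does not depend on the particle process: the two events differ only if
there is a long path of bad sites. -/
theorem IsLocallyMaximalThinning.measure_approx {d : ℕ} (hd : 1 ≤ d) {γ₀ : ℝ} {J₁ M k R D₀ : ℕ}
    (hJ₁ : 0 < J₁) (hM : 0 < M) {a : ℝ} (ha : ((J₁ * M : ℕ) : ℝ) ^ 2 ≤ a) {Ω₀ Ω : Type*}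
    [MeasurableSpace Ω₀] [MeasurableSpace Ω] {P₀ : Measure Ω₀} [IsProbabilityMeasure P₀]
    {Φ : Ω₀ → Config d} (hΦ : IsPoissonProcess P₀ (booleanIntensity d γ₀) Φ) {P : Measure Ω}
    {Ψ : Ω → Config d} (hΨ : IsLocallyMaximalThinning (expWeight a) P₀ Φ P Ψ)
    {A : Set (Config d)} (hA : MeasurableSet A) {ε : ENNReal}
    (hε : P₀ {ω | HasBadPath J₁ M k R D₀ (cellCounts (J₁ * M) (Φ ω))} ≤ ε) :
    P {ω | (Ψ ω).restrict (window d R) ∈ A} ≤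
        P₀ (Φ ⁻¹' approxEvent a (R + D₀ + 2 + badRange J₁ k) R A) + ε ∧
      P₀ (Φ ⁻¹' approxEvent a (R + D₀ + 2 + badRange J₁ k) R A) ≤
        P {ω | (Ψ ω).restrict (window d R) ∈ A} + ε := by
  set V := {ω | HasBadPath J₁ M k R D₀ (cellCounts (J₁ * M) (Φ ω))}
  set m := R + D₀ + 2 + badRange J₁ k with hm
  have hfin : ∀ φ : Config d, (φ.grains ∩ window d (m + 2)).Finite := fun φ =>
    finite_inter_window hd φ.2 _
  set D := approxEvent a m R A
  obtain ⟨S, hS, hmax⟩ := hΨ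
  have hPV : P (S ⁻¹' V) ≤ ε :=
    calc P (S ⁻¹' V) ≤ P (S ⁻¹' toMeasurable P₀ V) :=
          measure_mono (preimage_mono (subset_toMeasurable _ _))
      _ = P₀ V := by
          rw [hS.measurePreserving.measure_preimage
            (measurableSet_toMeasurable _ _).nullMeasurableSet, measure_toMeasurable]
      _ ≤ ε := hε
  have hPD : P (S ⁻¹' (Φ ⁻¹' D)) = P₀ (Φ ⁻¹' D) :=
    hS.measurePreserving.measure_preimage 
      (hΦ.measurable (measurableSet_approxEvent hd a m R hA)).nullMeasurableSet
  have hballs : ∀ᵐ ω ∂P, (Φ (S ω)).grains ⊆ unitBalls d :=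
    hS.measurePreserving.quasiMeasurePreserving.ae (ae_subset_unitBalls hd hΦ)
  have hiff : ∀ᵐ ω ∂P, S ω ∉ V →
      ((Ψ ω).restrict (window d R) ∈ A ↔ Φ (S ω) ∈ D) := by
    filter_upwards [hmax, hballs] with ω hω hB hωV
    have hwin : IsMaximalWithin (expWeight a) (window d m)
        ((Φ (S ω)).grains ∩ window d (m + 2)) ((Ψ ω).grains ∩ window d (m + 2)) := by
      refine hω.isMaximalWithin (finite_inter_window hd (Φ (S ω)).2 m) ?_
      intro K hK L hL hKL
      refine ⟨hB hL, ?_⟩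
      have h1 := dist_site_le_two hd (hB hK.1) (hB hL) hKL
      have h2 := mem_box.1 hK.2.2
      rw [mem_box]
      push_cast
      linarith [dist_triangle 0 (site K) (site L)]
    have hRW : window d R ⊆ window d (m + 2) := window_mono d (by omega)
    constructor
    · intro hΨ
      refine ⟨(Ψ ω).restrict (window d (m + 2)), ?_, hwin⟩
      have : ((Ψ ω).restrict (window d (m + 2))).restrict (window d R) =
          (Ψ ω).restrict (window d R) := Subtype.ext (by
        change (Ψ ω).grains ∩ window d (m + 2) ∩ window d R = (Ψ ω).grains ∩ window d R
        rw [inter_assoc, inter_eq_self_of_subset_right hRW])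
      rwa [mem_preimage, this]
    · rintro ⟨ψ, hψA, hψ⟩
      have heq := inter_window_eq_of_no_badPath hd hJ₁ hM ha (fun K hK => hK.1)
        (hfin (Φ (S ω))) hwin hψ hm.ge hωV
      have : (Ψ ω).restrict (window d R) = ψ.restrict (window d R) := Subtype.ext (by
        change (Ψ ω).grains ∩ window d R = ψ.grains ∩ window d R
        rw [← heq, inter_assoc, inter_eq_self_of_subset_right hRW])
      rwa [this]
  constructor
  · calc P {ω | (Ψ ω).restrict (window d R) ∈ A}
        ≤ P (S ⁻¹' (Φ ⁻¹' D) ∪ S ⁻¹' V) := by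
          refine measure_mono_ae (hiff.mono fun ω hω hΨ => ?_)
          by_cases hωV : S ω ∈ V
          · exact Or.inr hωV
          · exact Or.inl ((hω hωV).1 hΨ)
      _ ≤ P (S ⁻¹' (Φ ⁻¹' D)) + P (S ⁻¹' V) := measure_union_le _ _
      _ ≤ P₀ (Φ ⁻¹' D) + ε := by
          rw [hPD]
          gcongr
  · calc P₀ (Φ ⁻¹' D) = P (S ⁻¹' (Φ ⁻¹' D)) := hPD.symm
      _ ≤ P ({ω | (Ψ ω).restrict (window d R) ∈ A} ∪ S ⁻¹' V) := by
          refine measure_mono_ae (hiff.mono fun ω hω hΨ => ?_)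
          by_cases hωV : S ω ∈ V
          · exact Or.inr hωV
          · exact Or.inl ((hω hωV).2 hΨ)
      _ ≤ P {ω | (Ψ ω).restrict (window d R) ∈ A} + P (S ⁻¹' V) := measure_union_le _ _
      _ ≤ P {ω | (Ψ ω).restrict (window d R) ∈ A} + ε := by gcongr

theorem IsLocallyMaximalThinning.ae_restrict_eq {d : ℕ} (hd : 1 ≤ d) {γ₀ : ℝ}
    {h : Grain d → ℝ} {Ω₀ Ω : Type*} [MeasurableSpace Ω₀] [MeasurableSpace Ω] {P₀ : Measure Ω₀}
    [IsProbabilityMeasure P₀] {Φ : Ω₀ → Config d}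
    (hΦ : IsPoissonProcess P₀ (booleanIntensity d γ₀) Φ) {P : Measure Ω} {Ψ : Ω → Config d}
    (hΨ : IsLocallyMaximalThinning h P₀ Φ P Ψ) :
    ∀ᵐ ψ ∂(P.map Ψ), ψ.restrict (unitBalls d) = ψ := by
  obtain ⟨S, hS, -⟩ := hΨ
  have hballs : ∀ᵐ ω ∂P, (Φ (S ω)).grains ⊆ unitBalls d :=
    hS.measurePreserving.quasiMeasurePreserving.ae (ae_subset_unitBalls hd hΦ)
  have hset : {ψ : Config d | ψ.restrict (unitBalls d) = ψ} =
      Config.count (unitBalls d)ᶜ ⁻¹' {0} := by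
    ext ψ
    rw [mem_preimage, mem_singleton_iff, Config.count, Set.encard_eq_zero,
      ← disjoint_iff_inter_eq_empty, disjoint_compl_right_iff_subset, mem_ofPred_eq]
    constructor
    · intro h
      exact inter_eq_left.1 (congrArg Subtype.val h)
    · intro h
      exact Subtype.ext (inter_eq_left.2 h)
  have hmeas : MeasurableSet {ψ : Config d | ψ.restrict (unitBalls d) = ψ} := by
    rw [hset]
    exact measurable_count (measurableSet_unitBalls hd).compl (measurableSet_singleton 0)
  rw [ae_map_iff hS.measurable.aemeasurable hmeas]
  filter_upwards [hballs, hS.subset] with ω h1 h2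
  exact Subtype.ext (inter_eq_left.2 (h2.trans h1))

end HardCoreThinning

open HardCoreThinning in
theorem theorem6 (d : ℕ) (hd : 1 ≤ d) (γ₀ : ℝ) (hγ₀ : 0 < γ₀) :
    ∃ a₀ : ℝ, 1 ≤ a₀ ∧ ∀ a : ℝ, a₀ ≤ a →
      ∀ (Ω₀ : Type*) [MeasurableSpace Ω₀] (P₀ : Measure Ω₀) [IsProbabilityMeasure P₀]
        (Φ : Ω₀ → HardCoreThinning.Config d),
      HardCoreThinning.IsPoissonProcess P₀ (HardCoreThinning.booleanIntensity d γ₀) Φ →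
      ∀ (Ω₁ : Type*) [MeasurableSpace Ω₁] (P₁ : Measure Ω₁) [IsProbabilityMeasure P₁]
        (Ψ₁ : Ω₁ → HardCoreThinning.Config d)
        (Ω₂ : Type*) [MeasurableSpace Ω₂] (P₂ : Measure Ω₂) [IsProbabilityMeasure P₂]
        (Ψ₂ : Ω₂ → HardCoreThinning.Config d),
      HardCoreThinning.IsLocallyMaximalThinning (HardCoreThinning.expWeight a) P₀ Φ P₁ Ψ₁ →
      HardCoreThinning.IsLocallyMaximalThinning (HardCoreThinning.expWeight a) P₀ Φ P₂ Ψ₂ →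
      IdentDistrib Ψ₁ Ψ₂ P₁ P₂ := by
  obtain ⟨J₁, M, k, hJ₁, hM, hbound⟩ := exists_badBound_le d hγ₀
  have hJ : (1 : ℝ) ≤ (J₁ * M : ℕ) := by exact_mod_cast Nat.mul_pos hJ₁ hM
  refine ⟨((J₁ * M : ℕ) : ℝ) ^ 2, one_le_pow₀ hJ, ?_⟩
  intro a ha Ω₀ _ P₀ _ Φ hΦ Ω₁ _ P₁ _ Ψ₁ Ω₂ _ P₂ _ Ψ₂ h₁ h₂
  have hm₁ : Measurable Ψ₁ := h₁.choose_spec.1.measurable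
  have hm₂ : Measurable Ψ₂ := h₂.choose_spec.1.measurable
  refine ⟨hm₁.aemeasurable, hm₂.aemeasurable, ?_⟩
  have hp₁ : IsProbabilityMeasure (P₁.map Ψ₁) := Measure.isProbabilityMeasure_map hm₁.aemeasurable
  have hp₂ : IsProbabilityMeasure (P₂.map Ψ₂) := Measure.isProbabilityMeasure_map hm₂.aemeasurable
  refine measure_eq_of_restrict_window hd (h₁.ae_restrict_eq hd hΦ) (h₂.ae_restrict_eq hd hΦ)
    fun R A hA => ?_
  have hpre := measurable_restrict (measurableSet_window hd R) hA
  rw [Measure.map_apply hm₁ hpre, Measure.map_apply hm₂ hpre]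
  have key : ∀ ε : ENNReal, 0 < ε →
      P₁ (Ψ₁ ⁻¹' (Config.restrict (window d R) ⁻¹' A)) ≤
        P₂ (Ψ₂ ⁻¹' (Config.restrict (window d R) ⁻¹' A)) + (ε + ε) ∧
      P₂ (Ψ₂ ⁻¹' (Config.restrict (window d R) ⁻¹' A)) ≤
        P₁ (Ψ₁ ⁻¹' (Config.restrict (window d R) ⁻¹' A)) + (ε + ε) := by
    intro ε hε
    obtain ⟨D₀, hD₀⟩ := exists_measure_badPath_le hd hγ₀ hΦ hJ₁ hM hbound R hε
    obtain ⟨h11, h12⟩ := h₁.measure_approx hd hJ₁ hM ha hΦ hA hD₀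
    obtain ⟨h21, h22⟩ := h₂.measure_approx hd hJ₁ hM ha hΦ hA hD₀
    constructor
    · rw [← add_assoc]
      exact h11.trans (add_le_add_left h22 ε)
    · rw [← add_assoc]
      exact h21.trans (add_le_add_left h12 ε)
  have hhalf : ∀ ε : NNReal, 0 < ε → (0 : ENNReal) < ε / 2 := fun ε hε => by simpa using hε.ne'
  refine le_antisymm ?_ ?_
  · refine ENNReal.le_of_forall_pos_le_add fun ε hε _ => ?_
    simpa only [ENNReal.add_halves] using (key (ε / 2) (hhalf ε hε)).1
  · refine ENNReal.le_of_forall_pos_le_add fun ε hε _ => ?_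
    simpa only [ENNReal.add_halves] using (key (ε / 2) (hhalf ε hε)).2
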